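/- Let $L\ge 2$ be a constant and let $(a_1,\dots,a_L)$ be a fixed vector of integers with $a_1\ge a_2\ge\dots\ge a_L\ge 0$ and $a_2=a_3=\dots=a_L$. Let $M$ be a finite set of candidates. An up-to-$L$ vote is a ranking of $\ell$ distinct candidates of $M$ for some $1\le \ell\le L$. Under down-rounding positional scoring, the candidate ranked $j$-th in a vote that ranks $\ell$ candidates gets $a_{L-\ell+j}$ points from this vote, and an unranked candidate gets $0$ points. The winner of a profile (a finite list) of votes is the candidate with the largest total score, ties being broken by a given linear priority order on the candidates. Consider the following decision problem. Input: the set $M$ of $m$ candidates, listed in the order of tie-breaking priority, a profile $P$ of $n$ known up-to-$L$ votes, the number $t\ge 0$ of absent votes, and a candidate $c\in M$. Question: is there a profile $P'$ of exactly $t$ up-to-$L$ votes such that $c$ is the winner of the combined profile $P\cup P'$? This problem can be decided by a Turing machine in time polynomial in the size of the input, where $t$ is encoded in unary; that is, in time polynomial in $m$, $n$ and $t$. -/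

import Mathlib

/-- Up-to-`L` rankings of the candidates `0, …, m - 1`: lists, without repetition, of at least one
and at most `L` candidates, the most preferred candidate first. -/
def UpToVote (L m : ℕ) : Type :=
  {R : List (Fin m) // R.Nodup ∧ 1 ≤ R.length ∧ R.length ≤ L}

namespace UpToVote

variable {L m : ℕ}

theorem position_lt (V : UpToVote L m) {x : Fin m} (hx : x ∈ V.1) :
    L - V.1.length + V.1.idxOf x < L := by
  have h1 := List.idxOf_lt_length_of_mem hx
  have h2 := V.2.2.2
  omega

/-- The down-rounding score of candidate `x` in the vote `V` for the scoring vector `a`: with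
1-based indices, the `j`-th candidate of an `ℓ`-ranking gets `a_{L - ℓ + j}`; a candidate that is
not ranked gets `0`. (The indices of `Fin L` and of `List.idxOf` start at `0`.) -/
def downScore (a : Fin L → ℕ) (V : UpToVote L m) (x : Fin m) : ℕ :=
  if hx : x ∈ V.1 then a ⟨L - V.1.length + V.1.idxOf x, V.position_lt hx⟩ else 0

end UpToVote

section Rule

variable {L m : ℕ}

/-- The total score of candidate `x` in the profile `P`. -/
def profileScore (a : Fin L → ℕ) (P : List (UpToVote L m)) (x : Fin m) : ℕ :=
  (P.map fun V => V.downScore a x).sum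

/-- The candidates of maximal total score. -/
def topScorers (a : Fin L → ℕ) (P : List (UpToVote L m)) : Finset (Fin m) :=
  {x | ∀ y, profileScore a P y ≤ profileScore a P x}

theorem topScorers_nonempty [Nonempty (Fin m)] (a : Fin L → ℕ) (P : List (UpToVote L m)) :
    (topScorers a P).Nonempty := by
  obtain ⟨x, hx⟩ := Finite.exists_max (profileScore a P)
  exact ⟨x, by simpa [topScorers] using hx⟩

/-- The winner under the down-rounding positional scoring rule: among the candidates of maximal
score the one with the highest tie-breaking priority. Candidates are numbered in the order of the
tie-breaking priority, candidate `0` having the highest priority. -/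
def downWinner [Nonempty (Fin m)] (a : Fin L → ℕ) (P : List (UpToVote L m)) : Fin m :=
  (topScorers a P).min' (topScorers_nonempty a P)

end Rule

/-- An input of the problem "winner with absent votes" in the up-to-`L` setting. -/
structure WAVInstance (L : ℕ) where
  /-- the number of candidates; the candidates are `0, …, numCandidates - 1`, listed by
  tie-breaking priority -/
  numCandidates : ℕ
  /-- the profile of the known votes -/
  known : List (UpToVote L numCandidates)
  /-- the number of absent votes -/
  numAbsent : ℕ
  /-- the target candidate -/
  target : Fin numCandidates

namespace WAVInstance

variable {L : ℕ}

/-- The question: can the absent votes be cast such that the target candidate wins? -/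
def IsYes (a : Fin L → ℕ) (I : WAVInstance L) : Prop :=
  haveI : Nonempty (Fin I.numCandidates) := ⟨I.target⟩
  ∃ P' : List (UpToVote L I.numCandidates),
    P'.length = I.numAbsent ∧ downWinner a (I.known ++ P') = I.target

open Computability in
/-- A number in unary. -/
def encodeUnary (n : ℕ) : List Γ' :=
  List.replicate n (Γ'.bit true)

open Computability in
/-- A vote as a bracketed list of candidates. -/
def encodeVote {m : ℕ} (V : UpToVote L m) : List Γ' :=
  Γ'.bra :: (V.1.flatMap fun x => encodeUnary x.val ++ [Γ'.comma]) ++ [Γ'.ket]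

open Computability in
/-- The encoding of an input as a string. Its length is at least the number of candidates, of known
votes and of absent votes, and for fixed `L` it is polynomially bounded in these three numbers. -/
def encode (I : WAVInstance L) : List Γ' :=
  encodeUnary I.numCandidates ++ Γ'.comma ::
    (encodeUnary I.numAbsent ++ Γ'.comma ::
      (encodeUnary I.target.val ++ Γ'.comma :: I.known.flatMap encodeVote))

end WAVInstance

/-- The decision problem `Q` on inputs of type `α`, encoded as strings by `enc`, is decided by a
(multi-stack) Turing machine in time polynomial in the length of the encoded input. -/
def DecidableInPolyTime {α Γ : Type} (enc : α → List Γ) (Q : α → Prop) : Prop :=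
  ∃ f : α → Bool, (∀ x, f x = true ↔ Q x) ∧
    Nonempty (Turing.TM2ComputableInPolyTime enc Computability.encodeBool f)

/-!
Write the scoring vector as `(b + d, b, …, b)`: a vote gives `b` points to each ranked candidate,
and `d` more to its top candidate if it is complete, that is, if it ranks `L` candidates. We may
assume that every absent vote has the target at the top, and that the incomplete ones rank only the
target, since this leaves the fewest points to the rivals. If exactly `k` absent votes are complete,
the score of the target is fixed, and with it the number of votes that may rank each rival, its
capacity. The `k` rankings can be filled if and only if the capacities, capped at `k`, have a
sufficiently large sum: fill one ranking after the other, always preferring the candidates whose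
capacity exceeds the number of the later rankings.

So one has to compute, for each `k` up to the number of absent votes, an expression built from the
scores in the known votes by sums and comparisons. Programs over registers whose loops run over the
input word can do this, and a multi-stack Turing machine executes such a program in polynomial time.
-/

open Turing

/-! ### Programs over registers and their execution by Turing machines -/

/-- Programs over registers `R` holding natural numbers, which read an input word over `Γ`. The
only loops are `forIn`, which runs its body once for every symbol of the input word, and `drain`. -/
inductive LoopProgram (Γ R : Type) : Type
  | skip
  | inc (r : R)
  | dec (r : R)
  /-- subtract the contents of `r` from `t`, and clear `r` -/
  | drain (r t : R)
  | seq (p q : LoopProgram Γ R)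
  /-- run `p` if the register `r` is zero, and `q` otherwise -/
  | ifz (r : R) (p q : LoopProgram Γ R)
  | forIn (body : Γ → LoopProgram Γ R)

namespace LoopProgram

variable {Γ R : Type}

/-- The register contents after running a program on the input word `w`. -/
def run [DecidableEq R] (w : List Γ) : LoopProgram Γ R → (R → ℕ) → R → ℕ
  | skip, s => s
  | inc r, s => Function.update s r (s r + 1)
  | dec r, s => Function.update s r (s r - 1)
  | drain r t, s => Function.update (Function.update s t (s t - s r)) r 0
  | seq p q, s => q.run w (p.run w s)
  | ifz r p q, s => if s r = 0 then p.run w s else q.run w s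
  | forIn body, s => w.foldl (fun s x => (body x).run w s) s

theorem run_drain_of_ne_zero [DecidableEq R] (w : List Γ) {r : R} (t : R) {s : R → ℕ}
    (hr : s r ≠ 0) :
    (drain r t : LoopProgram Γ R).run w s =
      (drain r t : LoopProgram Γ R).run w ((dec t : LoopProgram Γ R).run w
        ((dec r : LoopProgram Γ R).run w s)) := by
  ext x
  obtain rfl | hrt := eq_or_ne r t
  · simp [run]
  · simp only [run, Function.update_apply, hrt, hrt.symm, if_true, if_false]
    split_ifs <;> omega

/-- The nesting depth of the loops over the input word. -/
def depth [Fintype Γ] : LoopProgram Γ R → ℕ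
  | skip | inc _ | dec _ | drain _ _ => 0
  | seq p q | ifz _ p q => max p.depth q.depth
  | forIn body => (Finset.univ.sup fun x => (body x).depth) + 1

/-- A bound on the running time, as a polynomial in the length of the input word. The time is
amortized: a step which decreases a register is paid for by the step that increased it. -/
noncomputable def cost [Fintype Γ] : LoopProgram Γ R → Polynomial ℕ
  | skip | dec _ | drain _ _ => 1
  | inc _ => 2
  | seq p q => p.cost + q.cost
  | ifz _ p q => 1 + p.cost + q.cost
  | forIn body => Polynomial.X * (∑ x, (body x).cost + 2) + 2

/-- The labels of the Turing machine code of a program. -/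
def Label : LoopProgram Γ R → Type
  | skip | inc _ | dec _ | drain _ _ => Unit
  | seq p q => p.Label ⊕ q.Label
  | ifz _ p q => Option (p.Label ⊕ q.Label)
  | forIn body => Bool ⊕ (Σ x, (body x).Label)

/-- The label at which the code of a program is entered. -/
def entry : (p : LoopProgram Γ R) → p.Label
  | skip | inc _ | dec _ | drain _ _ => ()
  | seq p _ => Sum.inl p.entry
  | ifz _ _ _ => none
  | forIn _ => Sum.inl false

@[reducible]
def fintypeLabel [Fintype Γ] : (p : LoopProgram Γ R) → Fintype p.Label
  | skip | inc _ | dec _ | drain _ _ => inferInstanceAs (Fintype Unit)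
  | seq p q =>
    haveI := p.fintypeLabel
    haveI := q.fintypeLabel
    inferInstanceAs (Fintype (p.Label ⊕ q.Label))
  | ifz _ p q =>
    haveI := p.fintypeLabel
    haveI := q.fintypeLabel
    inferInstanceAs (Fintype (Option (p.Label ⊕ q.Label)))
  | forIn body =>
    haveI := fun x => (body x).fintypeLabel
    inferInstanceAs (Fintype (Bool ⊕ (Σ x, (body x).Label)))

/-- The stacks of the machine, apart from the output: the input, the registers in unary, and for
every loop level `i : ι` the symbols still to be read and the symbols already read. -/
inductive Stack (R ι : Type) : Type
  | input
  | reg (r : R)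
  | loop (i : ι)
  | spool (i : ι)
  deriving DecidableEq, Fintype

/-- The stack alphabets; the stack `none` is the output. -/
abbrev Alphabet (Γ R ι : Type) : Option (Stack R ι) → Type
  | none => Bool
  | some _ => Γ

/-- The contents of the stacks of the machine, the registers being counted as numbers. -/
structure Memory (Γ R ι : Type) where
  /-- the part of the input not yet read -/
  input : List Γ := []
  /-- the values of the registers -/
  reg : R → ℕ := 0
  /-- for every loop level the symbols still to be read -/
  loop : ι → List Γ := fun _ => []
  /-- for every loop level the symbols already read, the last one first -/
  spool : ι → List Γ := fun _ => []
  /-- the output -/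
  output : List Bool := []

variable {ι Λ : Type}

namespace Memory

/-- The stacks that hold the given contents. -/
def contents [Inhabited Γ] (μ : Memory Γ R ι) :
    (k : Option (Stack R ι)) → List (Alphabet Γ R ι k)
  | none => μ.output
  | some .input => μ.input
  | some (.reg r) => List.replicate (μ.reg r) default
  | some (.loop i) => μ.loop i
  | some (.spool i) => μ.spool i

/-- In the loops of the levels in `d` the whole word `w` is still to be read. -/
def Rewound (μ : Memory Γ R ι) (w : List Γ) (d : Set ι) : Prop :=
  ∀ i ∈ d, μ.loop i = w ∧ μ.spool i = []

theorem Rewound.mono {μ : Memory Γ R ι} {w : List Γ} {d d' : Set ι} (h : μ.Rewound w d)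
    (hd : d' ⊆ d) : μ.Rewound w d' :=
  fun i hi => h i (hd hi)

variable [Inhabited Γ] [DecidableEq R] [DecidableEq ι] (μ : Memory Γ R ι)

theorem update_contents_input (u : List Γ) :
    Function.update μ.contents (some .input) u = { μ with input := u }.contents := by
  ext1 k
  obtain _ | _ | _ | _ | _ := k <;> simp [contents]

theorem update_contents_reg (r : R) (n : ℕ) :
    Function.update μ.contents (some (.reg r)) (List.replicate n default) =
      { μ with reg := Function.update μ.reg r n }.contents := by
  ext1 k
  obtain _ | _ | t | _ | _ := k
  case some.reg => obtain rfl | h := eq_or_ne t r <;> simp [contents, *]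
  all_goals simp [contents]

theorem update_contents_loop (i : ι) (u : List Γ) :
    Function.update μ.contents (some (.loop i)) u =
      { μ with loop := Function.update μ.loop i u }.contents := by
  ext1 k
  obtain _ | _ | _ | j | _ := k
  case some.loop => obtain rfl | h := eq_or_ne j i <;> simp [contents, *]
  all_goals simp [contents]

theorem update_contents_spool (i : ι) (u : List Γ) :
    Function.update μ.contents (some (.spool i)) u =
      { μ with spool := Function.update μ.spool i u }.contents := by
  ext1 k
  obtain _ | _ | _ | _ | j := k
  case some.spool => obtain rfl | h := eq_or_ne j i <;> simp [contents, *]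
  all_goals simp [contents]

theorem update_contents_output (u : List Bool) :
    Function.update μ.contents none u = { μ with output := u }.contents := by
  ext1 k
  obtain _ | _ | _ | _ | _ := k <;> simp [contents]

end Memory

/-- Pop the stack `k`, and go on with `q`, or jump to `l` if the stack is empty. -/
def popOr (k : Stack R ι) (q : TM2.Stmt (Alphabet Γ R ι) Λ (Option Γ)) (l : Λ) :
    TM2.Stmt (Alphabet Γ R ι) Λ (Option Γ) :=
  .pop (some k) (fun _ x => x) (.branch Option.isSome q (.goto fun _ => l))

section PopOr

variable [DecidableEq R] [DecidableEq ι] {k : Stack R ι}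
  {q : TM2.Stmt (Alphabet Γ R ι) Λ (Option Γ)} {l : Λ} {v : Option Γ}
  {S : (k : Option (Stack R ι)) → List (Alphabet Γ R ι k)}

theorem stepAux_popOr_nil (hS : S (some k) = []) :
    TM2.stepAux (popOr k q l) v S = ⟨some l, none, S⟩ := by
  have hv : (S (some k)).head? = none := by rw [hS]; rfl
  have hupd : Function.update S (some k) (S (some k)).tail = S := by rw [hS, ← hS]; simp [hS]
  simp only [popOr, TM2.stepAux, hv, hupd, Option.isSome_none, cond_false]

theorem stepAux_popOr_cons {x : Γ} {u : List Γ} (hS : S (some k) = x :: u) :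
    TM2.stepAux (popOr k q l) v S = TM2.stepAux q (some x) (Function.update S (some k) u) := by
  have hv : (S (some k)).head? = some x := by rw [hS]; rfl
  have hu : (S (some k)).tail = u := by rw [hS]; rfl
  simp only [popOr, TM2.stepAux, hv, hu, Option.isSome_some, cond_true]

end PopOr

section Code

variable [Inhabited Γ]

/-- The machine code of a program which is embedded into a machine by `emb`, jumps to `exit` in the
end, and uses the loop level `e j` for loops of depth `j + 1`. -/
def code [Fintype Γ] (e : ℕ → ι) : (p : LoopProgram Γ R) → (p.Label → Λ) → Λ → p.Label →
    TM2.Stmt (Alphabet Γ R ι) Λ (Option Γ)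
  | skip, _, exit, _ => .goto fun _ => exit
  | inc r, _, exit, _ => .push (some (.reg r)) (fun _ => default) (.goto fun _ => exit)
  | dec r, _, exit, _ => .pop (some (.reg r)) (fun v _ => v) (.goto fun _ => exit)
  | drain r t, emb, exit, _ =>
    popOr (.reg r) (.pop (some (.reg t)) (fun v _ => v) (.goto fun _ => emb ())) exit
  | seq p q, emb, exit, l =>
    match l with
    | .inl l => p.code e (fun l => emb (.inl l)) (emb (.inr q.entry)) l
    | .inr l => q.code e (fun l => emb (.inr l)) exit l
  | ifz r p q, emb, exit, l =>
    match l with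
    | none => .peek (some (.reg r)) (fun _ x => x) (.branch Option.isSome
        (.goto fun _ => emb (some (.inr q.entry))) (.goto fun _ => emb (some (.inl p.entry))))
    | some (.inl l) => p.code e (fun l => emb (some (.inl l))) exit l
    | some (.inr l) => q.code e (fun l => emb (some (.inr l))) exit l
  | forIn body, emb, exit, l =>
    let i := e (Finset.univ.sup fun x => (body x).depth)
    match l with
    | .inl false => popOr (.loop i) (.push (some (.spool i)) (fun v => v.getD default)
        (.goto fun v => emb (.inr ⟨v.getD default, (body (v.getD default)).entry⟩)))
        (emb (.inl true))
    | .inl true => popOr (.spool i) (.push (some (.loop i)) (fun v => v.getD default)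
        (.goto fun _ => emb (.inl true))) exit
    | .inr ⟨x, l⟩ => (body x).code e (fun l => emb (.inr ⟨x, l⟩)) (emb (.inl false)) l

variable [DecidableEq R] [DecidableEq ι]

theorem stepAux_pop_reg (r : R) (q : TM2.Stmt (Alphabet Γ R ι) Λ (Option Γ)) (v : Option Γ)
    (μ : Memory Γ R ι) :
    TM2.stepAux (.pop (some (.reg r)) (fun v _ => v) q) v μ.contents =
      TM2.stepAux q v { μ with reg := Function.update μ.reg r (μ.reg r - 1) }.contents := by
  rw [← μ.update_contents_reg, TM2.stepAux, ← List.tail_replicate]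
  rfl

variable [Fintype R]

omit [Inhabited Γ] in
theorem sum_update_add (s : R → ℕ) (r : R) (n : ℕ) :
    ∑ t, Function.update s r n t + s r = ∑ t, s t + n := by
  rw [Finset.sum_update_of_mem (Finset.mem_univ r), ← Finset.add_sum_erase _ s (Finset.mem_univ r),
    Finset.sdiff_singleton_eq_erase]
  omega

/-- The machine `M` gets from label `l` with memory `μ` to label `l'` with memory `μ'` in amortized
time `c`, the potential of a memory being the sum of its registers. -/
def Transits (M : Λ → TM2.Stmt (Alphabet Γ R ι) Λ (Option Γ)) (c : ℕ) (l : Λ) (μ : Memory Γ R ι)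
    (l' : Λ) (μ' : Memory Γ R ι) : Prop :=
  ∀ v, ∃ v' n, Nonempty (StateTransition.EvalsToInTime (TM2.step M) ⟨some l, v, μ.contents⟩
    (some ⟨some l', v', μ'.contents⟩) n) ∧ n + ∑ r, μ'.reg r ≤ c + ∑ r, μ.reg r

variable {M : Λ → TM2.Stmt (Alphabet Γ R ι) Λ (Option Γ)} {c c' : ℕ} {l l' l'' : Λ}
  {μ μ' μ'' : Memory Γ R ι}

theorem Transits.mono (h : Transits M c l μ l' μ') (hc : c ≤ c') : Transits M c' l μ l' μ' :=
  fun v => by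
    obtain ⟨v', n, hn, hle⟩ := h v
    exact ⟨v', n, hn, by omega⟩

theorem Transits.trans (h : Transits M c l μ l' μ') (h' : Transits M c' l' μ' l'' μ'') :
    Transits M (c + c') l μ l'' μ'' := fun v => by
  obtain ⟨v', n, ⟨hn⟩, hle⟩ := h v
  obtain ⟨v'', n', ⟨hn'⟩, hle'⟩ := h' v'
  exact ⟨v'', n' + n, ⟨hn.trans _ _ _ _ _ _ hn'⟩, by omega⟩

theorem Transits.single
    (hstep : ∀ v, ∃ v', TM2.stepAux (M l) v μ.contents = ⟨some l', v', μ'.contents⟩)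
    (hc : 1 + ∑ r, μ'.reg r ≤ c + ∑ r, μ.reg r) : Transits M c l μ l' μ' := fun v => by
  obtain ⟨v', hv'⟩ := hstep v
  exact ⟨v', 1, ⟨⟨1, congrArg some hv'⟩, le_rfl⟩, hc⟩

theorem Transits.single_of_reg_eq
    (hstep : ∀ v, ∃ v', TM2.stepAux (M l) v μ.contents = ⟨some l', v', μ'.contents⟩)
    (hreg : μ'.reg = μ.reg) : Transits M 1 l μ l' μ' :=
  .single hstep (by rw [hreg])

theorem transits_inc {r : R}
    (hM : M l = .push (some (.reg r)) (fun _ => default) (.goto fun _ => l')) :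
    Transits M 2 l μ l' { μ with reg := Function.update μ.reg r (μ.reg r + 1) } := by
  refine .single (fun v => ⟨v, ?_⟩) ?_
  · rw [hM, ← μ.update_contents_reg, List.replicate_succ]
    rfl
  · have := sum_update_add μ.reg r (μ.reg r + 1)
    dsimp only
    omega

theorem transits_dec {r : R}
    (hM : M l = .pop (some (.reg r)) (fun v _ => v) (.goto fun _ => l')) :
    Transits M 1 l μ l' { μ with reg := Function.update μ.reg r (μ.reg r - 1) } := by
  refine .single (fun v => ⟨v, ?_⟩) ?_
  · rw [hM, stepAux_pop_reg]
    rfl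
  · have := sum_update_add μ.reg r (μ.reg r - 1)
    dsimp only
    omega

theorem transits_drain {r t : R}
    (hM : M l = popOr (.reg r) (.pop (some (.reg t)) (fun v _ => v) (.goto fun _ => l)) l')
    (w : List Γ) (μ : Memory Γ R ι) :
    Transits M 1 l μ l' { μ with reg := (drain r t : LoopProgram Γ R).run w μ.reg } := by
  obtain hr | hr := eq_or_ne (μ.reg r) 0
  · have hrun : (drain r t : LoopProgram Γ R).run w μ.reg = μ.reg := by
      ext x
      simp only [run, Function.update_apply, hr, Nat.sub_zero]
      split_ifs <;> simp_all
    rw [hrun]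
    exact .single_of_reg_eq (fun v => ⟨none, by
      rw [hM, stepAux_popOr_nil (by simp [Memory.contents, hr])]⟩) rfl
  · set s := (dec r : LoopProgram Γ R).run w μ.reg with hs
    set s' := (dec t : LoopProgram Γ R).run w s with hs'
    have hsum : ∑ x, s x + 1 = ∑ x, μ.reg x := by
      have := sum_update_add μ.reg r (μ.reg r - 1)
      simp only [hs, run]
      omega
    have hsum' : ∑ x, s' x ≤ ∑ x, s x := by
      have := sum_update_add s t (s t - 1)
      simp only [hs', run]
      omega
    have hstep : Transits M 0 l μ l { μ with reg := s' } := by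
      refine .single (fun v => ⟨some default, ?_⟩) (by dsimp only; omega)
      have hcons : μ.contents (some (.reg r)) =
          default :: List.replicate (μ.reg r - 1) default := by
        rw [← List.replicate_succ, Nat.sub_add_cancel (Nat.pos_of_ne_zero hr)]
        rfl
      rw [hM, stepAux_popOr_cons hcons, μ.update_contents_reg, stepAux_pop_reg]
      rfl
    have : s' r < μ.reg r := by
      simp only [hs', hs, run, Function.update_apply]
      obtain rfl | hrt := eq_or_ne r t <;> simp [*] <;> omega
    rw [run_drain_of_ne_zero w t hr]
    exact hstep.trans (transits_drain hM w { μ with reg := s' })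
termination_by μ.reg r

theorem transits_foldl {i : ι} {start : Γ → Λ} {f : (R → ℕ) → Γ → R → ℕ}
    (hM : M l = popOr (.loop i) (.push (some (.spool i)) (fun v => v.getD default)
      (.goto fun v => start (v.getD default))) l') {d : Set ι} (hi : i ∉ d) {w : List Γ}
    (hbody : ∀ x μ, μ.Rewound w d →
      Transits M c (start x) μ l { μ with reg := f μ.reg x }) {u : List Γ} {μ : Memory Γ R ι}
    (hμ : μ.Rewound w d) (hu : μ.loop i = u) :
    Transits M (u.length * (c + 1) + 1) l μ l' { μ with
      reg := u.foldl f μ.reg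
      loop := Function.update μ.loop i []
      spool := Function.update μ.spool i (u.reverse ++ μ.spool i) } := by
  induction u generalizing μ with
  | nil =>
    rw [List.length_nil, Nat.zero_mul]
    refine .single_of_reg_eq (fun v => ⟨none, ?_⟩) rfl
    have hloop : Function.update μ.loop i [] = μ.loop := by simp [← hu]
    rw [hM, stepAux_popOr_nil hu]
    simp [hloop]
  | cons x u ih =>
    set μ₁ : Memory Γ R ι := { μ with
      loop := Function.update μ.loop i u, spool := Function.update μ.spool i (x :: μ.spool i) }
      with hμ₁
    have hpop : Transits M 1 l μ (start x) μ₁ :=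
      .single_of_reg_eq (fun v => ⟨some x, by
        rw [hM, stepAux_popOr_cons hu, μ.update_contents_loop, TM2.stepAux,
          Memory.update_contents_spool]
        rfl⟩) rfl
    have hμ₁' : μ₁.Rewound w d := fun j hj => by
      have hji : j ≠ i := fun h => hi (h ▸ hj)
      simpa [hμ₁, hji] using hμ j hj
    have hrest := ih (μ := { μ₁ with reg := f μ₁.reg x }) hμ₁' (Function.update_self ..)
    have hall := (hpop.trans (hbody x μ₁ hμ₁')).trans hrest
    simp only [hμ₁, Function.update_idem, Function.update_self] at hall
    convert hall using 1
    · simp only [List.length_cons]; ring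
    · simp

theorem transits_unspool {i : ι}
    (hM : M l = popOr (.spool i) (.push (some (.loop i)) (fun v => v.getD default)
      (.goto fun _ => l)) l') {u : List Γ} {μ : Memory Γ R ι} (hu : μ.spool i = u) :
    Transits M (u.length + 1) l μ l' { μ with
      loop := Function.update μ.loop i (u.reverse ++ μ.loop i)
      spool := Function.update μ.spool i [] } := by
  induction u generalizing μ with
  | nil =>
    refine .single_of_reg_eq (fun v => ⟨none, ?_⟩) rfl
    have hspool : Function.update μ.spool i [] = μ.spool := by simp [← hu]
    rw [hM, stepAux_popOr_nil hu]
    simp [hspool]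
  | cons x u ih =>
    set μ₁ : Memory Γ R ι := { μ with
      loop := Function.update μ.loop i (x :: μ.loop i), spool := Function.update μ.spool i u }
      with hμ₁
    have hpop : Transits M 1 l μ l μ₁ :=
      .single_of_reg_eq (fun v => ⟨some x, by
        rw [hM, stepAux_popOr_cons hu, μ.update_contents_spool, TM2.stepAux,
          Memory.update_contents_loop]
        rfl⟩) rfl
    have hall := hpop.trans (ih (μ := μ₁) (Function.update_self ..))
    simp only [hμ₁, Function.update_idem, Function.update_self] at hall
    convert hall using 1
    · simp only [List.length_cons]; ring
    · simp

theorem transits_rewound {i : ι} {start : Γ → Λ} {f : (R → ℕ) → Γ → R → ℕ}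
    (hM : M l = popOr (.loop i) (.push (some (.spool i)) (fun v => v.getD default)
      (.goto fun v => start (v.getD default))) l')
    (hM' : M l' = popOr (.spool i) (.push (some (.loop i)) (fun v => v.getD default)
      (.goto fun _ => l')) l'')
    {d : Set ι} (hi : i ∉ d) {w : List Γ}
    (hbody : ∀ x μ, μ.Rewound w d → Transits M c (start x) μ l { μ with reg := f μ.reg x })
    (hμ : μ.Rewound w (insert i d)) :
    Transits M (w.length * (c + 2) + 2) l μ l'' { μ with reg := w.foldl f μ.reg } := by
  obtain ⟨hloop, hspool⟩ := hμ i (Set.mem_insert i d)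
  have hread := transits_foldl hM hi hbody (hμ.mono (Set.subset_insert i d)) hloop
  have hall := hread.trans (transits_unspool hM' (Function.update_self ..))
  simp only [Function.update_idem, Function.update_self, hspool, List.append_nil,
    List.reverse_reverse] at hall
  convert hall using 1
  · simp only [List.length_reverse]; ring
  · rw [Function.update_eq_self_iff.2 hloop.symm, Function.update_eq_self_iff.2 hspool.symm]

theorem transits_peek {r : R} (hM : M l = .peek (some (.reg r)) (fun _ x => x)
      (.branch Option.isSome (.goto fun _ => l') (.goto fun _ => l''))) :
    Transits M 1 l μ (if μ.reg r = 0 then l'' else l') μ := by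
  refine .single_of_reg_eq (fun v => ⟨(List.replicate (μ.reg r) default).head?, ?_⟩) rfl
  rw [hM]
  obtain hr | hr := eq_or_ne (μ.reg r) 0 <;> simp [Memory.contents, List.head?_replicate, hr]

omit [Inhabited Γ] [DecidableEq R] [Fintype R] in
theorem eval_cost_le_eval_sum [Fintype Γ] (body : Γ → LoopProgram Γ R) (x : Γ) (n : ℕ) :
    (body x).cost.eval n ≤ (∑ x, (body x).cost).eval n := by
  rw [Polynomial.eval_finsetSum]
  exact Finset.single_le_sum (f := fun x => (body x).cost.eval n)
    (fun _ _ => Nat.zero_le _) (Finset.mem_univ x)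

theorem transits_forIn [Fintype Γ] {e : ℕ → ι} {w : List Γ} (body : Γ → LoopProgram Γ R)
    {emb : (forIn body).Label → Λ} (hM : ∀ k, M (emb k) = (forIn body).code e emb l' k)
    (he : Set.InjOn e (Set.Iio (forIn body).depth))
    (hbody : ∀ x ν, ν.Rewound w (e '' Set.Iio (Finset.univ.sup fun x => (body x).depth)) →
      Transits M ((body x).cost.eval w.length) (emb (.inr ⟨x, (body x).entry⟩)) ν
        (emb (.inl false)) { ν with reg := (body x).run w ν.reg })
    (hμ : μ.Rewound w (e '' Set.Iio (forIn body).depth)) :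
    Transits M ((forIn body).cost.eval w.length) (emb (forIn body).entry) μ l'
      { μ with reg := (forIn body).run w μ.reg } := by
  set n := Finset.univ.sup fun x => (body x).depth
  have hIio : Set.Iio (forIn body).depth = insert n (Set.Iio n) := Order.Iio_succ_eq_insert n
  rw [hIio] at he hμ
  rw [Set.image_insert_eq] at hμ
  obtain ⟨-, hn⟩ := (Set.injOn_insert (by simp)).1 he
  have hrun := transits_rewound (f := fun s x => (body x).run w s)
    (hM (.inl false)) (hM (.inl true)) hn
    (fun x ν hν => (hbody x ν hν).mono (eval_cost_le_eval_sum body x _)) hμ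
  simp only [cost, Polynomial.eval_add, Polynomial.eval_mul, Polynomial.eval_X,
    Polynomial.eval_ofNat]
  exact hrun

theorem transits_code [Fintype Γ] {e : ℕ → ι} {w : List Γ} (p : LoopProgram Γ R)
    {emb : p.Label → Λ} (hM : ∀ k, M (emb k) = p.code e emb l' k)
    (he : Set.InjOn e (Set.Iio p.depth)) (hμ : μ.Rewound w (e '' Set.Iio p.depth)) :
    Transits M (p.cost.eval w.length) (emb p.entry) μ l' { μ with reg := p.run w μ.reg } := by
  induction p generalizing l' μ with
  | skip =>
    rw [cost, Polynomial.eval_one]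
    exact .single_of_reg_eq (fun v => ⟨v, by rw [hM]; rfl⟩) rfl
  | inc r =>
    rw [cost, Polynomial.eval_ofNat]
    exact transits_inc (hM ())
  | dec r =>
    rw [cost, Polynomial.eval_one]
    exact transits_dec (hM ())
  | drain r t =>
    rw [cost, Polynomial.eval_one]
    exact transits_drain (hM ()) w μ
  | seq p q ihp ihq =>
    rw [cost, Polynomial.eval_add]
    have hp := ihp (fun k => hM (.inl k)) (he.mono (Set.Iio_subset_Iio (le_max_left ..)))
      (hμ.mono (Set.image_mono (Set.Iio_subset_Iio (le_max_left ..))))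
    have hq := ihq (μ := { μ with reg := p.run w μ.reg }) (fun k => hM (.inr k))
      (he.mono (Set.Iio_subset_Iio (le_max_right ..)))
      (hμ.mono (Set.image_mono (Set.Iio_subset_Iio (le_max_right ..))))
    exact hp.trans hq
  | ifz r p q ihp ihq =>
    have hp := ihp (fun k => hM (some (.inl k))) (he.mono (Set.Iio_subset_Iio (le_max_left ..)))
      (hμ.mono (Set.image_mono (Set.Iio_subset_Iio (le_max_left ..))))
    have hq := ihq (fun k => hM (some (.inr k))) (he.mono (Set.Iio_subset_Iio (le_max_right ..)))
      (hμ.mono (Set.image_mono (Set.Iio_subset_Iio (le_max_right ..))))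
    have htest := transits_peek (μ := μ) (hM none)
    simp only [cost, Polynomial.eval_add, Polynomial.eval_one, run]
    split_ifs at htest ⊢
    · exact (htest.trans hp).mono (by omega)
    · exact (htest.trans hq).mono (by omega)
  | forIn body ih =>
    have hle x : Set.Iio (body x).depth ⊆ Set.Iio (Finset.univ.sup fun x => (body x).depth) :=
      Set.Iio_subset_Iio (Finset.le_sup (f := fun x => (body x).depth) (Finset.mem_univ x))
    exact transits_forIn body hM he (fun x ν hν => ih x (fun k => hM (.inr ⟨x, k⟩))
      (he.mono ((hle x).trans (Set.Iio_subset_Iio (Nat.le_succ _))))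
      (hν.mono (Set.image_mono (hle x)))) hμ

end Code

section Machine

/-- The phases of the machine for a program: move the input to a spool, copy it to all loop stacks,
and, after the run of the program, write the answer and clear the other stacks. -/
inductive Phase : Type
  | read
  | copy
  | answer
  | clear
  deriving DecidableEq

instance : Fintype Phase :=
  ⟨{.read, .copy, .answer, .clear}, by rintro (_ | _ | _ | _) <;> simp⟩

/-- Pop from all stacks in `l`, and remember one of the popped symbols, if there is any. -/
def popAll (l : List (Stack R ι)) (q : TM2.Stmt (Alphabet Γ R ι) Λ (Option Γ)) :
    TM2.Stmt (Alphabet Γ R ι) Λ (Option Γ) :=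
  l.foldr (fun k q => .pop (some k) (fun v x => v <|> x) q) q

variable [Inhabited Γ]
/-- Push the last symbol read to all loop stacks in `l`. -/
def pushAll (l : List ι) (q : TM2.Stmt (Alphabet Γ R ι) Λ (Option Γ)) :
    TM2.Stmt (Alphabet Γ R ι) Λ (Option Γ) :=
  l.foldr (fun i q => .push (some (.loop i)) (fun v => v.getD default) q) q

theorem length_contents_le [Fintype R] (μ : Memory Γ R ι) (n : ℕ) (hin : μ.input.length ≤ n)
    (hreg : ∑ r, μ.reg r ≤ n) (hloop : ∀ i, (μ.loop i).length ≤ n)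
    (hspool : ∀ i, (μ.spool i).length ≤ n) (k : Stack R ι) :
    (μ.contents (some k)).length ≤ n := by
  obtain _ | r | i | i := k
  · exact hin
  · exact (List.length_replicate ..).trans_le
      ((Finset.single_le_sum (fun _ _ => Nat.zero_le _) (Finset.mem_univ r)).trans hreg)
  · exact hloop i
  · exact hspool i

variable [DecidableEq R] [DecidableEq ι]

theorem stepAux_pushAll {l : List ι} (hl : l.Nodup) (q : TM2.Stmt (Alphabet Γ R ι) Λ (Option Γ))
    (x : Γ) (μ : Memory Γ R ι) :
    TM2.stepAux (pushAll l q) (some x) μ.contents = TM2.stepAux q (some x)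
      { μ with loop := fun i => if i ∈ l then x :: μ.loop i else μ.loop i }.contents := by
  induction l generalizing μ with
  | nil => simp [pushAll]
  | cons i l ih =>
    obtain ⟨hi, hl⟩ := List.nodup_cons.1 hl
    have hpush : TM2.stepAux (pushAll (i :: l) q) (some x) μ.contents = TM2.stepAux (pushAll l q)
        (some x) { μ with loop := Function.update μ.loop i (x :: μ.loop i) }.contents := by
      rw [← μ.update_contents_loop]
      rfl
    rw [hpush, ih hl]
    congr 3
    ext1 j
    obtain rfl | hj := eq_or_ne j i <;> simp [*]

omit [Inhabited Γ] in
theorem stepAux_popAll {l : List (Stack R ι)} (hl : l.Nodup)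
    (q : TM2.Stmt (Alphabet Γ R ι) Λ (Option Γ)) (v : Option Γ)
    (S : (k : Option (Stack R ι)) → List (Alphabet Γ R ι k)) :
    TM2.stepAux (popAll l q) v S =
      TM2.stepAux q (v <|> l.findSome? fun k => (S (some k)).head?)
        (fun k => if k ∈ l.map some then (S k).tail else S k) := by
  induction l generalizing v S with
  | nil => simp [popAll]
  | cons k l ih =>
    obtain ⟨hk, hl⟩ := List.nodup_cons.1 hl
    have hne {j} (hj : j ∈ l) : j ≠ k := fun h => hk (h ▸ hj)
    have hpop : TM2.stepAux (popAll (k :: l) q) v S = TM2.stepAux (popAll l q)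
        (v <|> (S (some k)).head?) (Function.update S (some k) (S (some k)).tail) := rfl
    rw [hpop, ih hl]
    congr 1
    · let f : Stack R ι → Option Γ := fun j =>
        (Function.update S (some k) (S (some k)).tail (some j)).head?
      let g : Stack R ι → Option Γ := fun j => (S (some j)).head?
      have hmap : l.map f = l.map g := List.map_congr_left fun j hj =>
        congrArg List.head? (Function.update_of_ne (by simpa using hne hj) _ _)
      have hfind : l.findSome? f = l.findSome? g := by
        simpa [List.findSome?_map] using congrArg (List.findSome? id) hmap
      change ((v <|> g k) <|> l.findSome? f) = (v <|> (k :: l).findSome? g)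
      rw [hfind, List.findSome?_cons]
      cases v <;> cases g k <;> rfl
    · ext1 j
      obtain rfl | hj := eq_or_ne j (some k) <;> simp [*]

variable [Fintype Γ] [Fintype R]

/-- The code of the machine which runs a program on its input, and decides whether the register
`ans` is nonzero in the end. -/
noncomputable def machineCode (p : LoopProgram Γ R) (ans : R) : p.Label ⊕ Phase →
    TM2.Stmt (Alphabet Γ R (Fin (p.depth + 1))) (p.Label ⊕ Phase) (Option Γ)
  | .inl l => p.code (Fin.ofNat (p.depth + 1)) .inl (.inr .answer) l
  | .inr .read => popOr .input (.push (some (.spool 0)) (fun v => v.getD default)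
      (.goto fun _ => .inr .read)) (.inr .copy)
  | .inr .copy => popOr (.spool 0) (pushAll (List.finRange _) (.goto fun _ => .inr .copy))
      (.inl p.entry)
  | .inr .answer => .peek (some (.reg ans)) (fun _ x => x)
      (.push none Option.isSome (.goto fun _ => .inr .clear))
  | .inr .clear => .load (fun _ => none) (popAll Finset.univ.toList
      (.branch Option.isSome (.goto fun _ => .inr .clear) .halt))

/-- The machine which runs a program on its input, and decides whether the register `ans` is nonzero
in the end. -/
noncomputable def machine (p : LoopProgram Γ R) (ans : R) : FinTM2 :=
  haveI := p.fintypeLabel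
  { K := Option (Stack R (Fin (p.depth + 1)))
    k₀ := some .input
    k₁ := none
    Γ := Alphabet Γ R (Fin (p.depth + 1))
    Λ := p.Label ⊕ Phase
    main := .inr .read
    σ := Option Γ
    initialState := none
    Γk₀Fin := inferInstanceAs (Fintype Γ)
    m := p.machineCode ans }

variable (p : LoopProgram Γ R) (ans : R)

theorem transits_read (u : List Γ) (μ : Memory Γ R (Fin (p.depth + 1))) (hu : μ.input = u) :
    Transits (p.machineCode ans) (u.length + 1) (.inr .read) μ (.inr .copy) { μ with
      input := []
      spool := Function.update μ.spool 0 (u.reverse ++ μ.spool 0) } := by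
  have hM : p.machineCode ans (.inr .read) = popOr .input (.push (some (.spool 0))
    (fun v => v.getD default) (.goto fun _ => .inr .read)) (.inr .copy) := rfl
  induction u generalizing μ with
  | nil =>
    refine .single_of_reg_eq (fun v => ⟨none, ?_⟩) rfl
    rw [hM, stepAux_popOr_nil hu, List.reverse_nil, List.nil_append, Function.update_eq_self, ← hu]
  | cons x u ih =>
    have hpop : Transits (p.machineCode ans) 1 (.inr .read) μ (.inr .read) { μ with
        input := u, spool := Function.update μ.spool 0 (x :: μ.spool 0) } :=
      .single_of_reg_eq (fun v => ⟨some x, by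
        rw [hM, stepAux_popOr_cons hu, μ.update_contents_input, TM2.stepAux,
          Memory.update_contents_spool]
        rfl⟩) rfl
    convert hpop.trans (ih _ rfl) using 1
    · simp only [List.length_cons]; ring
    · simp

theorem transits_copy (u : List Γ) (μ : Memory Γ R (Fin (p.depth + 1))) (hu : μ.spool 0 = u) :
    Transits (p.machineCode ans) (u.length + 1) (.inr .copy) μ (.inl p.entry) { μ with
      loop := fun i => u.reverse ++ μ.loop i
      spool := Function.update μ.spool 0 [] } := by
  have hM : p.machineCode ans (.inr .copy) =
    popOr (.spool 0) (pushAll (List.finRange _) (.goto fun _ => .inr .copy)) (.inl p.entry) := rfl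
  induction u generalizing μ with
  | nil =>
    refine .single_of_reg_eq (fun v => ⟨none, ?_⟩) rfl
    have hspool : Function.update μ.spool 0 [] = μ.spool := by simp [← hu]
    rw [hM, stepAux_popOr_nil hu]
    simp [hspool]
  | cons x u ih =>
    have hpop : Transits (p.machineCode ans) 1 (.inr .copy) μ (.inr .copy) { μ with
        loop := fun i => x :: μ.loop i, spool := Function.update μ.spool 0 u } :=
      .single_of_reg_eq (fun v => ⟨some x, by
        rw [hM, stepAux_popOr_cons hu, μ.update_contents_spool,
          stepAux_pushAll (List.nodup_finRange _)]
        simp⟩) rfl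
    convert hpop.trans (ih _ (Function.update_self 0 u μ.spool)) using 1
    · simp only [List.length_cons]; ring
    · simp

theorem transits_answer (μ : Memory Γ R (Fin (p.depth + 1))) :
    Transits (p.machineCode ans) 1 (.inr .answer) μ (.inr .clear)
      { μ with output := decide (μ.reg ans ≠ 0) :: μ.output } := by
  refine .single_of_reg_eq (fun v => ⟨(List.replicate (μ.reg ans) default).head?, ?_⟩) rfl
  have hans : decide (μ.reg ans ≠ 0) =
      (List.replicate (μ.reg ans) (default : Γ)).head?.isSome := by
    rw [List.head?_replicate]
    split_ifs with h <;> simp [h]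
  rw [hans]
  exact congrArg (TM2.Cfg.mk _ _) (μ.update_contents_output _)

theorem evalsToInTime_clear (n : ℕ) (v : Option Γ)
    (S : (k : Option (Stack R (Fin (p.depth + 1)))) → List (Alphabet Γ R _ k))
    (hS : ∀ k, (S (some k)).length ≤ n) :
    Nonempty (StateTransition.EvalsToInTime (TM2.step (p.machineCode ans))
      ⟨some (.inr .clear), v, S⟩
      (some ⟨none, none, Function.update (fun _ => []) none (S none)⟩) (n + 1)) := by
  set S' : (k : Option (Stack R (Fin (p.depth + 1)))) → List (Alphabet Γ R _ k) :=
    fun k => if k ∈ Finset.univ.toList.map some then (S k).tail else S k with hS'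
  have hnone : S' none = S none := by simp [hS']
  have hsome k : S' (some k) = (S (some k)).tail := by simp [hS']
  have hstep : TM2.step (p.machineCode ans) ⟨some (.inr .clear), v, S⟩ =
      some (TM2.stepAux (.branch Option.isSome (.goto fun _ => .inr .clear) .halt)
        (Finset.univ.toList.findSome? fun k => (S (some k)).head?) S') := by
    rw [TM2.step, machineCode, TM2.stepAux, stepAux_popAll (Finset.nodup_toList _)]
    rfl
  cases hx : Finset.univ.toList.findSome? fun k => (S (some k)).head? with
  | none =>
    have hnil k : S (some k) = [] := by simpa using List.findSome?_eq_none_iff.1 hx k (by simp)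
    refine ⟨⟨1, hstep.trans ?_⟩, Nat.le_add_left 1 n⟩
    have hS'' : S' = Function.update (fun _ => []) none (S none) := by
      ext1 k
      cases k <;> simp [hnone, hsome, hnil]
    rw [hx, hS'']
    rfl
  | some x =>
    obtain ⟨k, -, hk⟩ := List.exists_of_findSome?_eq_some hx
    have hpos : 0 < (S (some k)).length := List.length_pos_of_mem (List.mem_of_mem_head? hk)
    obtain ⟨n, rfl⟩ := Nat.exists_eq_succ_of_ne_zero (hpos.trans_le (hS k)).ne'
    obtain ⟨hrest⟩ := evalsToInTime_clear n (some x) S' fun k => by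
      rw [hsome, List.length_tail]
      exact Nat.sub_le_of_le_add (hS k)
    rw [hx] at hstep
    exact ⟨hnone ▸ StateTransition.EvalsToInTime.trans _ 1 _ _ _ _ ⟨⟨1, hstep⟩, le_rfl⟩ hrest⟩
termination_by n

theorem initList_machine (w : List Γ) : initList (p.machine ans) w =
    ⟨some (.inr .read), none, Memory.contents { input := w }⟩ := by
  unfold initList
  congr 1
  ext1 k
  obtain _ | _ | r | i | i := k <;> rfl

theorem haltList_machine (b : Bool) : haltList (p.machine ans) [b] =
    ⟨none, none, Function.update (fun _ => []) none [b]⟩ := by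
  unfold haltList
  congr 1
  ext1 k
  obtain _ | k := k <;> rfl

theorem transits_run (w : List Γ) :
    Transits (p.machineCode ans) (p.cost.eval w.length + 2 * w.length + 3) (.inr .read)
      { input := w } (.inr .clear)
      { reg := p.run w 0, loop := fun _ => w, output := [decide (p.run w 0 ans ≠ 0)] } := by
  have he : Set.InjOn (Fin.ofNat (p.depth + 1)) (Set.Iio p.depth) := fun i hi j hj h => by
    simpa [Nat.mod_eq_of_lt (Nat.lt_succ_of_lt (Set.mem_Iio.1 hi)),
      Nat.mod_eq_of_lt (Nat.lt_succ_of_lt (Set.mem_Iio.1 hj))] using congrArg Fin.val h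
  have hload := (p.transits_read ans w { input := w } rfl).trans
    (p.transits_copy ans w.reverse _ (by simp))
  simp only [Function.update_idem, Function.update_eq_self_iff.2 rfl, List.reverse_reverse,
    List.append_nil] at hload
  have hrun := (hload.trans (transits_code (w := w) p (l' := .inr .answer) (fun _ => rfl) he
    fun _ _ => ⟨rfl, by simp⟩)).trans (p.transits_answer ans _)
  refine hrun.mono ?_
  rw [List.length_reverse]
  omega

theorem outputsInTime_machine (w : List Γ) :
    Nonempty (TM2OutputsInTime (p.machine ans) w (some [decide (p.run w 0 ans ≠ 0)])
      ((2 * (p.cost + 2 * Polynomial.X + 3) + 1 : Polynomial ℕ).eval w.length)) := by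
  obtain ⟨v, n, ⟨hrun⟩, hn⟩ := p.transits_run ans w none
  set N := p.cost.eval w.length + 2 * w.length + 3
  have hn0 : ∑ r, (0 : R → ℕ) r = 0 := by simp
  dsimp only at hn
  obtain ⟨hclear⟩ := p.evalsToInTime_clear ans N v (Memory.contents
      { reg := p.run w 0, loop := fun _ => w, output := [decide (p.run w 0 ans ≠ 0)] }) <|
    length_contents_le _ N (Nat.zero_le _) (show ∑ r, p.run w 0 r ≤ N by omega)
      (fun _ => show w.length ≤ N by omega) (fun _ => Nat.zero_le _)
  have hall := hrun.trans _ _ _ _ _ _ hclear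
  refine ⟨?_⟩
  unfold TM2OutputsInTime
  rw [initList_machine, Option.map_some, haltList_machine]
  refine ⟨hall.toEvalsTo, hall.steps_le_m.trans ?_⟩
  simp only [Polynomial.eval_add, Polynomial.eval_mul, Polynomial.eval_X, Polynomial.eval_ofNat,
    Polynomial.eval_one]
  omega

end Machine

theorem decidableInPolyTime [Inhabited Γ] [Finite Γ] [Finite R] [DecidableEq R] {α : Type}
    {enc : α → List Γ} {Q : α → Prop} (p : LoopProgram Γ R) (ans : R)
    (hp : ∀ x, p.run (enc x) 0 ans ≠ 0 ↔ Q x) : DecidableInPolyTime enc Q := by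
  cases nonempty_fintype Γ
  cases nonempty_fintype R
  exact ⟨fun x => decide (p.run (enc x) 0 ans ≠ 0), fun x => by simpa using hp x,
    ⟨{ tm := p.machine ans
       inputAlphabet := Equiv.refl Γ
       outputAlphabet := Equiv.refl Bool
       time := 2 * (p.cost + 2 * Polynomial.X + 3) + 1
       outputsFun := fun x => by
        have hid : List.map (Equiv.refl Γ).invFun (enc x) = enc x := List.map_id _
        exact hid.symm ▸ (p.outputsInTime_machine ans (enc x)).some }⟩⟩

end LoopProgram

/-! ### Functions evaluated by programs -/

namespace LoopProgram

variable {R R' Γ : Type}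

/-- The program which uses the register `f r` in place of `r`. -/
def map (f : R → R') : LoopProgram Γ R → LoopProgram Γ R'
  | skip => skip
  | inc r => inc (f r)
  | dec r => dec (f r)
  | drain r t => drain (f r) (f t)
  | seq p q => seq (p.map f) (q.map f)
  | ifz r p q => ifz (f r) (p.map f) (q.map f)
  | forIn body => forIn fun x => (body x).map f

/-- Increment the registers in a list one after the other. -/
def incs (l : List R) : LoopProgram Γ R :=
  l.foldr (fun r p => seq (inc r) p) skip

/-- Set a register to zero. -/
def clear (r : R) : LoopProgram Γ R :=
  drain r r

/-- Run a program as often as there are symbols in the input word. -/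
def loop (p : LoopProgram Γ R) : LoopProgram Γ R :=
  forIn fun _ => p

/-- Add a register to the registers in a list, and set it to zero. -/
def transfer (r : R) (l : List R) : LoopProgram Γ R :=
  loop (ifz r skip (seq (dec r) (incs l)))

/-- Add `r` to `t`, by way of the register `tmp`. -/
def copy (r t tmp : R) : LoopProgram Γ R :=
  seq (transfer r [t, tmp]) (transfer tmp [r])

variable [DecidableEq R] [DecidableEq R'] (w : List Γ)

theorem run_map_comp {f : R → R'} (hf : Function.Injective f) (p : LoopProgram Γ R) (s : R' → ℕ) :
    (p.map f).run w s ∘ f = p.run w (s ∘ f) := by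
  induction p generalizing s with
  | skip => rfl
  | inc r => exact Function.update_comp_eq_of_injective s hf r _
  | dec r => exact Function.update_comp_eq_of_injective s hf r _
  | drain r t =>
    simp only [map, run, Function.update_comp_eq_of_injective _ hf, Function.comp_apply]
  | seq p q ihp ihq => rw [map, run, ihq, ihp, run]
  | ifz r p q ihp ihq =>
    simp only [map, run, Function.comp_apply]
    split_ifs
    · exact ihp s
    · exact ihq s
  | forIn body ih =>
    simp only [map, run]
    exact (List.foldl_hom (· ∘ f) fun s x => (ih x s).symm).symm

omit [DecidableEq R] in
theorem run_map_of_notMem_range {f : R → R'} {r : R'} (hr : r ∉ Set.range f)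
    (p : LoopProgram Γ R) (s : R' → ℕ) : (p.map f).run w s r = s r := by
  have hne t : r ≠ f t := fun h => hr ⟨t, h.symm⟩
  induction p generalizing s with
  | skip => rfl
  | inc t | dec t => exact Function.update_of_ne (hne t) _ s
  | drain t t' =>
    exact (Function.update_of_ne (hne t) _ _).trans (Function.update_of_ne (hne t') _ s)
  | seq p q ihp ihq => rw [map, run, ihq, ihp]
  | ifz t p q ihp ihq =>
    simp only [map, run]
    split_ifs
    · exact ihp s
    · exact ihq s
  | forIn body ih =>
    exact List.foldlRecOn (motive := fun s' => s' r = s r) w _ rfl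
      fun s' hs' x _ => (ih x s').trans hs'

theorem run_incs (l : List R) (s : R → ℕ) :
    (incs l : LoopProgram Γ R).run w s = fun x => s x + l.count x := by
  induction l generalizing s with
  | nil => rfl
  | cons r l ih =>
    change (incs l : LoopProgram Γ R).run w (Function.update s r (s r + 1)) = _
    rw [ih]
    ext1 x
    obtain rfl | hx := eq_or_ne x r
    · simp only [Function.update_self, List.count_cons_self]
      ring
    · rw [Function.update_of_ne hx, List.count_cons_of_ne hx.symm]

theorem run_clear (r : R) (s : R → ℕ) :
    (clear r : LoopProgram Γ R).run w s = Function.update s r 0 :=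
  Function.update_idem ..

theorem run_loop (p : LoopProgram Γ R) (s : R → ℕ) :
    (loop p).run w s = (p.run w)^[w.length] s :=
  List.foldl_const ..

theorem run_transfer {r : R} {l : List R} (hr : r ∉ l) {s : R → ℕ} (hs : s r ≤ w.length) :
    (transfer r l).run w s = fun x => if x = r then 0 else s x + l.count x * s r := by
  set p : LoopProgram Γ R := ifz r skip (seq (dec r) (incs l)) with hp
  have hstep i : (p.run w)^[i] s =
      fun x => if x = r then s r - i else s x + l.count x * min i (s r) := by
    induction i with
    | zero =>
      ext1 x
      split_ifs with hx <;> simp [hx]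
    | succ i ih =>
      rw [Function.iterate_succ_apply', ih]
      ext1 x
      simp only [hp, run, run_incs, if_true, Function.update_apply]
      obtain rfl | hx := eq_or_ne x r
      · rw [if_pos rfl]
        split_ifs with hi <;> simp only [if_true, List.count_eq_zero_of_not_mem hr] <;> omega
      · split_ifs with hi
        · simp [hx, min_eq_right (Nat.sub_eq_zero_iff_le.1 hi),
            min_eq_right ((Nat.sub_eq_zero_iff_le.1 hi).trans (Nat.le_succ i))]
        · have hi : i + 1 ≤ s r := by omega
          simp only [hx, if_false, min_eq_left hi, min_eq_left ((Nat.le_succ i).trans hi)]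
          ring
  rw [transfer, run_loop, hstep, min_eq_right hs, Nat.sub_eq_zero_of_le hs]

theorem run_copy {r t tmp : R} (hrt : r ≠ t) (hr : r ≠ tmp) (ht : t ≠ tmp) {s : R → ℕ}
    (hs : s r ≤ w.length) (hs0 : s tmp = 0) :
    (copy r t tmp).run w s = Function.update s t (s t + s r) := by
  have hs' : (transfer r [t, tmp]).run w s =
      fun x => if x = r then 0 else s x + [t, tmp].count x * s r := run_transfer w (by simp [*]) hs
  rw [copy, run, hs', run_transfer w (by simp [hr.symm]) (by simp [hs0, hr.symm, ht, hs])]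
  ext1 x
  obtain rfl | htmp := eq_or_ne x tmp
  · simp [ht.symm, hs0]
  obtain rfl | hxr := eq_or_ne x r
  · simp [hr, hr.symm, hrt, ht, hs0]
  obtain rfl | hxt := eq_or_ne x t
  · simp [htmp, htmp.symm, hxr, hxr.symm]
  · simp [htmp, htmp.symm, hxr, hxr.symm, hxt, hxt.symm]

end LoopProgram

section Evaluable

open LoopProgram

variable {α Γ : Type} {n : ℕ} {ι κ : Type}

/-- The registers of a program that evaluates a function of `n` arguments: the register to which the
value is added, the arguments, and registers for intermediate results. -/
inductive Port (n : ℕ) (ι : Type) : Type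
  | acc
  | arg (i : Fin n)
  | temp (t : ι)
  deriving DecidableEq, Fintype

namespace Port

/-- The register contents with the given values of `acc`, the arguments and the other registers. -/
def valuation (k : ℕ) (e : Fin n → ℕ) (v : ι → ℕ) : Port n ι → ℕ
  | acc => k
  | arg i => e i
  | temp t => v t

/-- Rename `acc` to `a`, and the registers for intermediate results along `f`. -/
def embed (a : Port n κ) (f : ι → κ) : Port n ι → Port n κ
  | acc => a
  | arg i => arg i
  | temp t => temp (f t)

theorem embed_injective {a : Port n κ} {f : ι → κ} (hf : Function.Injective f)
    (harg : ∀ i, a ≠ arg i) (htemp : ∀ t, a ≠ temp (f t)) : Function.Injective (embed a f) := by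
  rintro (_ | i | t) (_ | j | t') h
  case acc.acc => rfl
  case arg.arg => exact congrArg arg (Port.arg.inj h)
  case temp.temp => exact congrArg temp (hf (Port.temp.inj h))
  case acc.arg => exact (harg j h).elim
  case arg.acc => exact (harg i h.symm).elim
  case acc.temp => exact (htemp t' h).elim
  case temp.acc => exact (htemp t h.symm).elim
  case arg.temp | temp.arg => cases h

variable [DecidableEq ι]

theorem update_valuation_acc (k k' : ℕ) (e : Fin n → ℕ) (v : ι → ℕ) :
    Function.update (valuation k e v) acc k' = valuation k' e v := by
  ext1 (_ | _ | _) <;> simp [valuation]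

theorem update_valuation_temp (k : ℕ) (e : Fin n → ℕ) (v : ι → ℕ) (t : ι) (j : ℕ) :
    Function.update (valuation k e v) (temp t) j = valuation k e (Function.update v t j) := by
  ext1 (_ | _ | t')
  case temp => obtain rfl | h := eq_or_ne t' t <;> simp [valuation, *]
  all_goals simp [valuation]

end Port

open Port

/-- The program `p` adds `F x e` to the register `acc`, when it is run on the word that encodes `x`
with the arguments `e`, provided that these are smaller than the length of this word. -/
def Computes [DecidableEq ι] (enc : α → List Γ) (p : LoopProgram Γ (Port n ι))
    (F : α → (Fin n → ℕ) → ℕ) : Prop :=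
  ∀ x k e, (∀ i, e i < (enc x).length) →
    p.run (enc x) (valuation k e 0) = valuation (k + F x e) e 0

/-- The function `F` is computed by a program. -/
def Evaluable (enc : α → List Γ) (F : α → (Fin n → ℕ) → ℕ) : Prop :=
  ∃ (ι : Type) (_ : Fintype ι) (_ : DecidableEq ι) (p : LoopProgram Γ (Port n ι)), Computes enc p F

variable {enc : α → List Γ} {F G : α → (Fin n → ℕ) → ℕ}

theorem Computes.run_map {R : Type} [DecidableEq R] [DecidableEq ι] {p : LoopProgram Γ (Port n ι)}
    (hp : Computes enc p F) {f : Port n ι → R} (hf : Function.Injective f) {x : α} {s : R → ℕ}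
    (harg : ∀ i, s (f (arg i)) < (enc x).length) (htemp : ∀ t, s (f (temp t)) = 0) :
    (p.map f).run (enc x) s =
      Function.update s (f acc) (s (f acc) + F x fun i => s (f (arg i))) := by
  have hs : s ∘ f = valuation (s (f acc)) (fun i => s (f (arg i))) 0 := by
    ext1 (_ | i | t)
    exacts [rfl, rfl, htemp t]
  have hrun := run_map_comp (enc x) hf p s
  rw [hs, hp x _ _ harg, ← update_valuation_acc (s (f acc)), ← hs,
    ← Function.update_comp_eq_of_injective _ hf] at hrun
  ext1 r
  by_cases hr : r ∈ Set.range f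
  · obtain ⟨q, rfl⟩ := hr
    exact congrFun hrun q
  · rw [run_map_of_notMem_range _ hr, Function.update_of_ne fun h => hr ⟨acc, h.symm⟩]

theorem Computes.run_embed [DecidableEq ι] [DecidableEq κ] {p : LoopProgram Γ (Port n ι)}
    (hp : Computes enc p F) {a : Port n κ} {f : ι → κ} (hf : Function.Injective f)
    (harg : ∀ i, a ≠ arg i) (htemp : ∀ t, a ≠ temp (f t)) {x : α} {k : ℕ} {e : Fin n → ℕ}
    {v : κ → ℕ} (he : ∀ i, e i < (enc x).length) (hv : ∀ t, v (f t) = 0) :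
    (p.map (embed a f)).run (enc x) (valuation k e v) =
      Function.update (valuation k e v) a (valuation k e v a + F x e) :=
  hp.run_map (embed_injective hf harg htemp) he hv

namespace Evaluable

theorem congr (hF : Evaluable enc F)
    (h : ∀ x e, (∀ i, e i < (enc x).length) → F x e = G x e) : Evaluable enc G := by
  obtain ⟨ι, hι, hι', p, hp⟩ := hF
  exact ⟨ι, hι, hι', p, fun x k e he => by rw [hp x k e he, h x e he]⟩

theorem const (c : ℕ) : Evaluable enc fun _ (_ : Fin n → ℕ) => c := by
  refine ⟨Empty, inferInstance, inferInstance, incs (List.replicate c acc), fun x k e _ => ?_⟩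
  rw [run_incs]
  ext1 (_ | _ | _) <;> simp [valuation, List.count_replicate]

theorem var (i : Fin n) : Evaluable enc fun _ e => e i := by
  refine ⟨Unit, inferInstance, inferInstance, copy (arg i) acc (temp ()), fun x k e he => ?_⟩
  have hrun := run_copy (enc x) (r := arg i) (t := acc) (tmp := temp ()) (s := valuation k e 0)
    (by simp) (by simp) (by simp) (he i).le rfl
  exact hrun.trans (update_valuation_acc ..)

theorem add (hF : Evaluable enc F) (hG : Evaluable enc G) :
    Evaluable enc fun x e => F x e + G x e := by
  obtain ⟨ι, _, _, p, hp⟩ := hF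
  obtain ⟨κ, _, _, q, hq⟩ := hG
  refine ⟨ι ⊕ κ, inferInstance, inferInstance,
    seq (p.map (embed acc Sum.inl)) (q.map (embed acc Sum.inr)), fun x k e he => ?_⟩
  rw [run, hp.run_embed Sum.inl_injective (by simp) (by simp) he (by simp), update_valuation_acc,
    hq.run_embed Sum.inr_injective (by simp) (by simp) he (by simp), update_valuation_acc]
  simp only [valuation, add_assoc]

theorem const_mul (c : ℕ) (hF : Evaluable enc F) : Evaluable enc fun x e => c * F x e := by
  induction c with
  | zero => exact (const 0).congr fun _ _ _ => by rw [zero_mul]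
  | succ c ih => exact (ih.add hF).congr fun _ _ _ => by rw [Nat.succ_mul]

end Evaluable

open Classical in
/-- The predicate `P` is decided by a program, which adds one to the register `acc` if it holds. -/
def EvaluablePred (enc : α → List Γ) (P : α → (Fin n → ℕ) → Prop) : Prop :=
  Evaluable enc fun x e => if P x e then 1 else 0

variable {P Q : α → (Fin n → ℕ) → Prop}

namespace EvaluablePred

theorem congr (hP : EvaluablePred enc P)
    (h : ∀ x e, (∀ i, e i < (enc x).length) → (P x e ↔ Q x e)) : EvaluablePred enc Q :=
  Evaluable.congr hP fun x e he => by rw [h x e he]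

theorem le (hF : Evaluable enc F) (hG : Evaluable enc G) :
    EvaluablePred enc fun x e => F x e ≤ G x e := by
  obtain ⟨ι, _, _, p, hp⟩ := hF
  obtain ⟨κ, _, _, q, hq⟩ := hG
  let lhs : Port n (Bool ⊕ ι ⊕ κ) := temp (.inl false)
  let rhs : Port n (Bool ⊕ ι ⊕ κ) := temp (.inl true)
  refine ⟨Bool ⊕ ι ⊕ κ, inferInstance, inferInstance,
    seq (p.map (embed lhs (.inr ∘ .inl))) (seq (q.map (embed rhs (.inr ∘ .inr)))
      (seq (drain rhs lhs) (seq (ifz lhs (inc acc) skip) (clear lhs)))), fun x k e he => ?_⟩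
  have hload : (q.map (embed rhs (.inr ∘ .inr))).run (enc x)
      ((p.map (embed lhs (.inr ∘ .inl))).run (enc x) (valuation k e 0)) = valuation k e
        (Function.update (Function.update 0 (.inl false) (F x e)) (.inl true) (G x e)) := by
    rw [hp.run_embed (Sum.inr_injective.comp Sum.inl_injective) (by simp [lhs]) (by simp [lhs])
      he (by simp), update_valuation_temp, hq.run_embed (Sum.inr_injective.comp Sum.inr_injective)
      (by simp [rhs]) (by simp [rhs]) he (by simp), update_valuation_temp]
    simp [valuation, lhs, rhs]
  have hdrain : (drain rhs lhs : LoopProgram Γ _).run (enc x) (valuation k e (Function.update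
      (Function.update 0 (.inl false) (F x e)) (.inl true) (G x e))) =
      valuation k e (Function.update 0 (.inl false) (F x e - G x e)) := by
    simp only [run, lhs, rhs, update_valuation_temp, valuation]
    congr 1
    ext1 ((_ | _) | _) <;> simp
  have htest : valuation k e (Function.update 0 (.inl false) (F x e - G x e)) lhs =
      F x e - G x e := by simp [valuation, lhs]
  rw [run, run, hload, run, hdrain, run, run_clear, run, htest]
  simp only [Nat.sub_eq_zero_iff_le, run, lhs]
  split_ifs <;> simp [update_valuation_acc, update_valuation_temp, valuation]

end EvaluablePred

namespace Evaluable

theorem ite [∀ x e, Decidable (P x e)] (hP : EvaluablePred enc P) (hF : Evaluable enc F)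
    (hG : Evaluable enc G) : Evaluable enc fun x e => if P x e then F x e else G x e := by
  obtain ⟨ι, _, _, p, hp⟩ := hP
  obtain ⟨κ₁, _, _, f, hf⟩ := hF
  obtain ⟨κ₂, _, _, g, hg⟩ := hG
  let test : Port n (Unit ⊕ ι ⊕ κ₁ ⊕ κ₂) := temp (.inl ())
  refine ⟨Unit ⊕ ι ⊕ κ₁ ⊕ κ₂, inferInstance, inferInstance,
    seq (p.map (embed test (.inr ∘ .inl))) (seq (ifz test
      (g.map (embed acc (.inr ∘ .inr ∘ .inr))) (f.map (embed acc (.inr ∘ .inr ∘ .inl))))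
      (clear test)), fun x k e he => ?_⟩
  have hinj₁ : Function.Injective (.inr ∘ .inr ∘ .inl : κ₁ → Unit ⊕ ι ⊕ κ₁ ⊕ κ₂) :=
    Sum.inr_injective.comp (Sum.inr_injective.comp Sum.inl_injective)
  have hinj₂ : Function.Injective (.inr ∘ .inr ∘ .inr : κ₂ → Unit ⊕ ι ⊕ κ₁ ⊕ κ₂) :=
    Sum.inr_injective.comp (Sum.inr_injective.comp Sum.inr_injective)
  rw [run, hp.run_embed (Sum.inr_injective.comp Sum.inl_injective) (by simp [test])
    (by simp [test]) he (by simp), update_valuation_temp, run, run, run_clear,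
    hf.run_embed hinj₁ (by simp) (by simp) he (by simp),
    hg.run_embed hinj₂ (by simp) (by simp) he (by simp), update_valuation_acc, update_valuation_acc]
  by_cases hx : P x e <;> simp [test, valuation, update_valuation_temp, hx]

theorem sum_length {F : α → (Fin (n + 1) → ℕ) → ℕ} (hF : Evaluable enc F) :
    Evaluable enc fun x e => ∑ i ∈ Finset.range (enc x).length, F x (Fin.cons i e) := by
  obtain ⟨ι, _, _, p, hp⟩ := hF
  let idx : Port n (Unit ⊕ ι) := temp (.inl ())
  let f : Port (n + 1) ι → Port n (Unit ⊕ ι)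
    | acc => acc
    | arg i => Fin.cons (α := fun _ => Port n (Unit ⊕ ι)) idx arg i
    | temp t => temp (.inr t)
  refine ⟨Unit ⊕ ι, inferInstance, inferInstance,
    seq (loop (seq (p.map f) (inc idx))) (clear idx), fun x k e he => ?_⟩
  have hf : Function.Injective f := by
    rintro (_ | i | t) (_ | j | t') h <;> try cases i using Fin.cases
    all_goals try cases j using Fin.cases
    all_goals simp_all [f, idx]
  have hstep i (hi : i ≤ (enc x).length) :
      ((seq (p.map f) (inc idx)).run (enc x))^[i] (valuation k e 0) =
        valuation (k + ∑ j ∈ Finset.range i, F x (Fin.cons j e)) e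
          (Function.update 0 (.inl ()) i) := by
    induction i with
    | zero => simp
    | succ i ih =>
      have harg : (fun j => valuation (k + ∑ j ∈ Finset.range i, F x (Fin.cons j e)) e
          (Function.update 0 (.inl ()) i) (f (arg j))) = Fin.cons i e := by
        ext1 j
        cases j using Fin.cases <;> simp [f, idx, valuation]
      have hlt (j : Fin (n + 1)) : (Fin.cons i e : Fin (n + 1) → ℕ) j < (enc x).length := by
        cases j using Fin.cases
        exacts [hi, he _]
      rw [Function.iterate_succ_apply', ih (Nat.le_of_succ_le hi), run,
        hp.run_map hf (fun j => (congrFun harg j).trans_lt (hlt j))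
          (fun _ => by simp [f, valuation]), harg]
      simp only [f, run, update_valuation_acc, idx, update_valuation_temp]
      simp [valuation, Finset.sum_range_succ, add_assoc]
  rw [run, run_loop, hstep _ le_rfl, run_clear, update_valuation_temp]
  simp

end Evaluable

namespace EvaluablePred

theorem not (hP : EvaluablePred enc P) : EvaluablePred enc fun x e => ¬P x e := by
  classical
  exact (Evaluable.ite hP (.const 0) (.const 1)).congr fun x e _ => by
    by_cases h : P x e <;> simp [h]

theorem and (hP : EvaluablePred enc P) (hQ : EvaluablePred enc Q) :
    EvaluablePred enc fun x e => P x e ∧ Q x e := by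
  classical
  exact (Evaluable.ite hP hQ (.const 0)).congr fun x e _ => by
    by_cases hp : P x e <;> simp [hp]

theorem lt (hF : Evaluable enc F) (hG : Evaluable enc G) :
    EvaluablePred enc fun x e => F x e < G x e :=
  (le hG hF).not.congr fun _ _ _ => not_le

theorem eq (hF : Evaluable enc F) (hG : Evaluable enc G) :
    EvaluablePred enc fun x e => F x e = G x e :=
  ((le hF hG).and (le hG hF)).congr fun _ _ _ => le_antisymm_iff.symm

end EvaluablePred

namespace Evaluable

variable {F : α → (Fin (n + 1) → ℕ) → ℕ} {P : α → (Fin (n + 1) → ℕ) → Prop}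

theorem tail (hG : Evaluable enc G) :
    Evaluable enc fun x (e : Fin (n + 1) → ℕ) => G x (Fin.tail e) := by
  obtain ⟨ι, _, _, p, hp⟩ := hG
  let f : Port n ι → Port (n + 1) ι
    | acc => acc
    | arg i => arg i.succ
    | temp t => temp t
  have hf : Function.Injective f := by
    rintro (_ | i | t) (_ | j | t') h <;> simp_all [f]
  exact ⟨ι, inferInstance, inferInstance, p.map f, fun x k e he =>
    (hp.run_map hf (s := valuation k e 0) (fun i => he i.succ) fun _ => rfl).trans
      (update_valuation_acc ..)⟩

theorem sum_range (hF : Evaluable enc F) (hG : Evaluable enc G)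
    (hle : ∀ x e, (∀ i, e i < (enc x).length) → G x e ≤ (enc x).length) :
    Evaluable enc fun x e => ∑ i ∈ Finset.range (G x e), F x (Fin.cons i e) := by
  refine (ite (EvaluablePred.lt (var 0) hG.tail) hF (const 0)).sum_length.congr fun x e he => ?_
  have hfilter : (Finset.range (enc x).length).filter (· < G x e) = Finset.range (G x e) := by
    ext i
    simpa using fun hi => hi.trans_le (hle x e he)
  simp only [Fin.cons_zero, Fin.tail_cons, ← hfilter, Finset.sum_filter]

theorem subst (hF : Evaluable enc F) (hG : Evaluable enc G)
    (hlt : ∀ x e, (∀ i, e i < (enc x).length) → G x e < (enc x).length) :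
    Evaluable enc fun x e => F x (Fin.cons (G x e) e) := by
  refine (ite (EvaluablePred.eq hG.tail (var 0)) hF (const 0)).sum_length.congr fun x e he => ?_
  simp only [Fin.cons_zero, Fin.tail_cons, Finset.sum_ite_eq, Finset.mem_range, hlt x e he, if_true]

theorem count [∀ x e, DecidablePred fun i => P x (Fin.cons i e)] (hP : EvaluablePred enc P)
    (hG : Evaluable enc G) (hle : ∀ x e, (∀ i, e i < (enc x).length) → G x e ≤ (enc x).length) :
    Evaluable enc fun x e => Nat.count (fun i => P x (Fin.cons i e)) (G x e) := by
  refine (sum_range hP hG hle).congr fun x e _ => ?_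
  rw [Nat.count_eq_card_filter_range, Finset.card_filter]
  congr! 1
  simp

end Evaluable

namespace EvaluablePred

variable {P : α → (Fin (n + 1) → ℕ) → Prop}

theorem forall_lt (hP : EvaluablePred enc P) (hG : Evaluable enc G)
    (hle : ∀ x e, (∀ i, e i < (enc x).length) → G x e ≤ (enc x).length) :
    EvaluablePred enc fun x e => ∀ i < G x e, P x (Fin.cons i e) := by
  classical
  exact (eq (Evaluable.count hP hG hle) hG).congr fun x e _ => Nat.count_iff_forall

theorem exists_lt (hP : EvaluablePred enc P) (hG : Evaluable enc G)
    (hle : ∀ x e, (∀ i, e i < (enc x).length) → G x e ≤ (enc x).length) :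
    EvaluablePred enc fun x e => ∃ i < G x e, P x (Fin.cons i e) :=
  (forall_lt hP.not hG hle).not.congr fun x e _ => by push Not; rfl

theorem decidableInPolyTime [Finite Γ] [Inhabited Γ] {Q : α → Prop}
    (hQ : EvaluablePred enc fun x (_ : Fin 0 → ℕ) => Q x) : DecidableInPolyTime enc Q := by
  obtain ⟨ι, _, _, p, hp⟩ := hQ
  refine p.decidableInPolyTime acc fun x => ?_
  have hzero : (0 : Port 0 ι → ℕ) = valuation 0 0 0 := by ext1 (_ | _ | _) <;> rfl
  rw [hzero, hp x 0 0 fun i => i.elim0]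
  simp [valuation]

end EvaluablePred

end Evaluable

/-! ### Filling complete rankings -/

theorem exists_finset_card_eq_mul_le_sum_min {ι : Type*} [Fintype ι] [DecidableEq ι] {n k : ℕ}
    {r : ι → ℕ} (h : (k + 1) * n ≤ ∑ x, min (r x) (k + 1)) :
    ∃ u : Finset ι, u.card = n ∧ (∀ x ∈ u, r x ≠ 0) ∧
      k * n ≤ ∑ x, min (r x - if x ∈ u then 1 else 0) k := by
  let large : Finset ι := {x | k < r x}
  let support : Finset ι := {x | r x ≠ 0}
  have hsubset : large ⊆ support := fun _ => by
    simp only [large, support, Finset.mem_filter_univ]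
    exact Nat.ne_zero_of_lt
  obtain hn | hn := le_total n large.card
  · obtain ⟨u, hu, hcard⟩ := Finset.exists_subset_card_eq hn
    refine ⟨u, hcard, fun x hx => (Finset.mem_filter_univ x).1 (hsubset (hu hx)), ?_⟩
    calc
      k * n ≤ ∑ _ ∈ large, k := by
        rw [Finset.sum_const, smul_eq_mul, mul_comm]
        exact Nat.mul_le_mul_right k hn
      _ ≤ ∑ x ∈ large, min (r x - if x ∈ u then 1 else 0) k := Finset.sum_le_sum fun x hx => by
        have hk : k < r x := (Finset.mem_filter_univ x).1 hx
        split_ifs <;> omega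
      _ ≤ _ := Finset.sum_le_univ_sum_of_nonneg fun _ => Nat.zero_le _
  · have hsupport : n ≤ support.card := by
      refine Nat.le_of_mul_le_mul_left (h.trans ?_) k.succ_pos
      rw [mul_comm, ← smul_eq_mul, ← Finset.sum_const, Finset.sum_filter]
      refine Finset.sum_le_sum fun x _ => ?_
      split_ifs <;> omega
    obtain ⟨u, hlarge, hu, hcard⟩ := Finset.exists_subsuperset_card_eq hsubset hn hsupport
    have hpos x (hx : x ∈ u) : r x ≠ 0 := (Finset.mem_filter_univ x).1 (hu hx)
    refine ⟨u, hcard, hpos, ?_⟩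
    have hmin x : min (r x) (k + 1) =
        min (r x - if x ∈ u then 1 else 0) k + if x ∈ u then 1 else 0 := by
      by_cases hx : x ∈ u
      · have := hpos x hx
        simp only [hx, if_true]
        omega
      · have : ¬k < r x := fun hk => hx (hlarge ((Finset.mem_filter_univ x).2 hk))
        simp only [hx, if_false]
        omega
    simp only [hmin, Finset.sum_add_distrib, Finset.sum_boole, Finset.filter_univ_mem, hcard,
      Nat.cast_id, Nat.succ_mul] at h
    exact Nat.le_of_add_le_add_right h

theorem exists_finsets_card_filter_mem_le {ι : Type*} [Fintype ι] [DecidableEq ι] {n k : ℕ}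
    {r : ι → ℕ} (h : k * n ≤ ∑ x, min (r x) k) :
    ∃ u : Fin k → Finset ι, (∀ i, (u i).card = n) ∧
      ∀ x, (Finset.univ.filter fun i => x ∈ u i).card ≤ r x := by
  induction k generalizing r with
  | zero => exact ⟨fun _ => ∅, Fin.elim0, by simp⟩
  | succ k ih =>
    obtain ⟨u, hu, hpos, hsum⟩ := exists_finset_card_eq_mul_le_sum_min h
    obtain ⟨v, hv, hle⟩ := ih hsum
    refine ⟨Fin.cons u v, Fin.cases hu hv, fun x => ?_⟩
    have hx := hle x
    have hpos := hpos x
    rw [Fin.card_filter_univ_succ]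
    simp only [Fin.cons_zero, Fin.cons_succ]
    split_ifs at hx ⊢ with hxu
    · have := hpos hxu
      omega
    · exact hx

section Votes

variable {L m : ℕ} {a : Fin L → ℕ} {b d : ℕ}

/-- The score of `y` in the ranking `R` when every ranked candidate gets `b` points and the top
candidate of a ranking of length `L` gets `d` points more. -/
def flatScore {β : Type} [DecidableEq β] (L b d : ℕ) (R : List β) (y : β) : ℕ :=
  (if y ∈ R then b else 0) + if R.head? = some y ∧ R.length = L then d else 0

theorem flatScore_map {β γ : Type} [DecidableEq β] [DecidableEq γ] {f : β → γ}
    (hf : Function.Injective f) (R : List β) (y : β) :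
    flatScore L b d (R.map f) (f y) = flatScore L b d R y := by
  simp only [flatScore, List.mem_map_of_injective hf, List.head?_map, List.length_map,
    Option.map_eq_some_iff, hf.eq_iff, exists_eq_right]

theorem flatScore_cons_self {β : Type} [DecidableEq β] (R : List β) (y : β) :
    flatScore L b d (y :: R) y = b + if R.length + 1 = L then d else 0 := by
  simp [flatScore]

theorem flatScore_cons_of_ne {β : Type} [DecidableEq β] {R : List β} {x y : β} (h : y ≠ x) :
    flatScore L b d (x :: R) y = if y ∈ R then b else 0 := by
  simp [flatScore, h, h.symm]

theorem UpToVote.downScore_eq_flatScore (ha : ∀ i, a i = if i.val = 0 then b + d else b)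
    (V : UpToVote L m) (x : Fin m) : V.downScore a x = flatScore L b d V.1 x := by
  by_cases hx : x ∈ V.1
  · have hhead : V.1.idxOf x = 0 ↔ V.1.head? = some x := by
      obtain ⟨y, R, hR⟩ := List.exists_cons_of_ne_nil (List.ne_nil_of_mem hx)
      rw [hR, List.head?_cons, Option.some_inj]
      by_cases hy : y = x <;> simp [hy]
    have htop : L - V.1.length + V.1.idxOf x = 0 ↔ V.1.head? = some x ∧ V.1.length = L := by
      rw [Nat.add_eq_zero_iff, Nat.sub_eq_zero_iff_le, hhead, and_comm, V.2.2.2.ge_iff_eq]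
    simp only [downScore, flatScore, hx, dif_pos, if_true, ha, htop]
    split_ifs <;> rfl
  · have hhead : V.1.head? ≠ some x := fun h => hx (List.mem_of_head? h)
    simp only [downScore, flatScore, hx, hhead, dif_neg, not_false_eq_true, if_false, false_and]

theorem profileScore_append (a : Fin L → ℕ) (P P' : List (UpToVote L m)) (x : Fin m) :
    profileScore a (P ++ P') x = profileScore a P x + profileScore a P' x := by
  simp only [profileScore, List.map_append, List.sum_append]

theorem mem_topScorers_iff (a : Fin L → ℕ) (P : List (UpToVote L m)) (x : Fin m) :
    x ∈ topScorers a P ↔ ∀ y, profileScore a P y ≤ profileScore a P x :=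
  Finset.mem_filter_univ x

theorem downWinner_eq_iff [Nonempty (Fin m)] (a : Fin L → ℕ) (P : List (UpToVote L m))
    (c : Fin m) : downWinner a P = c ↔
      ∀ y, profileScore a P y + (if y < c then 1 else 0) ≤ profileScore a P c := by
  have hmem := mem_topScorers_iff a P
  have hwin := (topScorers a P).min'_mem (topScorers_nonempty a P)
  constructor
  · rintro rfl y
    have hle := (hmem _).1 hwin y
    split_ifs with hy
    · refine Nat.succ_le_of_lt (hle.lt_of_ne fun heq => hy.not_ge ?_)
      exact Finset.min'_le _ _ ((hmem y).2 fun z => ((hmem _).1 hwin z).trans heq.ge)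
    · exact hle
  · intro h
    have hc : c ∈ topScorers a P := (hmem c).2 fun y => (Nat.le_add_right _ _).trans (h y)
    refine le_antisymm (Finset.min'_le _ c hc) (le_of_not_gt fun hlt => ?_)
    have hle := h (downWinner a P)
    rw [if_pos hlt] at hle
    exact (Nat.lt_of_succ_le hle).not_ge ((hmem _).1 hwin c)

namespace WAVInstance

variable (I : WAVInstance L) (b d k y j : ℕ)

/-- The score of candidate `y` in the known votes, if the scoring vector is `(b + d, b, …, b)`. It
takes a natural number, so that programs can pass a loop index. -/
def knownScore : ℕ :=
  (I.known.map fun V => flatScore L b d (V.1.map Fin.val) y).sum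

/-- Candidate `y` does not beat the target if it is ranked, not at the top, in `j` absent votes, and
all absent votes rank the target first, `k` of them being complete rankings. -/
def Fits : Prop :=
  I.knownScore b d y + (if y < I.target then 1 else 0) + j * b ≤
    I.knownScore b d I.target + I.numAbsent * b + k * d

instance : DecidablePred (I.Fits b d k y) := fun _ => Nat.decLe _ _

/-- The number of complete absent votes in which candidate `y` can be ranked without beating the
target, when there are `k` such votes. -/
def capacity : ℕ :=
  Nat.count (fun j => I.Fits b d k y (j + 1)) k

/-- For some `k`, no candidate beats the target from the start, and the candidates have enough
capacity to fill `k` complete rankings. The target itself contributes its capacity `k`. -/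
def Feasible : Prop :=
  ∃ k < I.numAbsent + 1, (∀ y < I.numCandidates, I.Fits b d k y 0) ∧
    k * L ≤ ∑ y ∈ Finset.range I.numCandidates, I.capacity b d k y

variable {I b d k y j}

theorem profileScore_known (ha : ∀ i, a i = if i.val = 0 then b + d else b)
    (x : Fin I.numCandidates) : profileScore a I.known x = I.knownScore b d x := by
  simp only [profileScore, knownScore, UpToVote.downScore_eq_flatScore ha,
    flatScore_map Fin.val_injective]

theorem Fits.mono {j' : ℕ} (h : I.Fits b d k y j) (hj : j' ≤ j) : I.Fits b d k y j' :=
  (Nat.add_le_add_left (Nat.mul_le_mul_right b hj) _).trans h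

theorem Fits.le_capacity (h : I.Fits b d k y j) (hj : j ≤ k) : j ≤ I.capacity b d k y := by
  have hcount : Nat.count (fun i => I.Fits b d k y (i + 1)) j = j :=
    Nat.count_iff_forall.2 fun _ hi => h.mono hi
  exact hcount.ge.trans (Nat.count_monotone _ hj)

theorem Fits.capacity (h : I.Fits b d k y 0) : I.Fits b d k y (I.capacity b d k y) := by
  have hcount n : I.Fits b d k y (Nat.count (fun j => I.Fits b d k y (j + 1)) n) := by
    induction n with
    | zero => exact h
    | succ n ih =>
      rw [Nat.count_succ]
      split_ifs with hn
      · exact hn.mono (Nat.succ_le_succ (Nat.count_le ..))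
      · exact ih
  exact hcount k

end WAVInstance

namespace UpToVote

/-- The complete rankings with top candidate `c`. They are the votes in which `c` gets `d`
additional points. -/
def IsFull (c : Fin m) (V : UpToVote L m) : Prop :=
  V.1.head? = some c ∧ V.1.length = L

instance (c : Fin m) : DecidablePred (IsFull c : UpToVote L m → Prop) := fun _ =>
  inferInstanceAs (Decidable (_ ∧ _))

theorem flatScore_le (V : UpToVote L m) (c : Fin m) :
    flatScore L b d V.1 c ≤ b + if V.IsFull c then d else 0 := by
  refine Nat.add_le_add_right ?_ _
  split_ifs
  exacts [le_rfl, Nat.zero_le b]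

theorem sum_mem_eq_length (V : UpToVote L m) : (∑ y, if y ∈ V.1 then 1 else 0) = V.1.length := by
  rw [← List.toFinset_card_of_nodup V.2.1, Finset.sum_boole, Nat.cast_id]
  congr 1
  ext y
  simp

/-- The ranking with top candidate `c`, followed by the candidates in `u` in some order. -/
noncomputable def ofTop (c : Fin m) (u : Finset (Fin m)) (hc : c ∉ u) (hu : u.card + 1 ≤ L) :
    UpToVote L m :=
  ⟨c :: u.toList, by simpa [u.nodup_toList] using hc, by simp, by simpa using hu⟩

end UpToVote

open UpToVote

theorem profileScore_ofFn_append_replicate (ha : ∀ i, a i = if i.val = 0 then b + d else b)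
    {k n : ℕ} (V : Fin k → UpToVote L m) (W : UpToVote L m) (y : Fin m) :
    profileScore a (List.ofFn V ++ List.replicate n W) y =
      ∑ i, flatScore L b d (V i).1 y + n * flatScore L b d W.1 y := by
  rw [profileScore_append]
  simp only [profileScore, List.map_ofFn, List.sum_ofFn, List.map_replicate, List.sum_replicate,
    smul_eq_mul, Function.comp_apply, downScore_eq_flatScore ha]

theorem exists_profile_of_finsets (hL : 1 ≤ L) (ha : ∀ i, a i = if i.val = 0 then b + d else b)
    {c : Fin m} {k n : ℕ} (hk : k ≤ n) {u : Fin k → Finset (Fin m)}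
    (hcard : ∀ i, (u i).card + 1 = L) (hu : ∀ i, c ∉ u i) :
    ∃ P : List (UpToVote L m), P.length = n ∧ n * b + k * d ≤ profileScore a P c ∧
      ∀ y ≠ c, profileScore a P y = (Finset.univ.filter fun i => y ∈ u i).card * b := by
  let full (i : Fin k) : UpToVote L m := ofTop c (u i) (hu i) (hcard i).le
  let single : UpToVote L m := ofTop c ∅ (Finset.notMem_empty _) (by simpa)
  let P := List.ofFn full ++ List.replicate (n - k) single
  have hscore y : profileScore a P y =
      ∑ i, flatScore L b d (c :: (u i).toList) y + (n - k) * flatScore L b d [c] y := by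
    rw [profileScore_ofFn_append_replicate ha]
    simp only [full, single, ofTop, Finset.toList_empty]
  refine ⟨P, by simp [P, Nat.add_sub_of_le hk], ?_, fun y hy => ?_⟩
  · have hfull i : flatScore L b d (c :: (u i).toList) c = b + d := by
      rw [flatScore_cons_self, Finset.length_toList, if_pos (hcard i)]
    have hsingle : b ≤ flatScore L b d [c] c := by
      rw [flatScore_cons_self]
      exact Nat.le_add_right _ _
    calc
      n * b + k * d = k * (b + d) + (n - k) * b := by
        obtain ⟨j, rfl⟩ := Nat.exists_eq_add_of_le hk
        rw [Nat.add_sub_cancel_left]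
        ring
      _ ≤ profileScore a P c := by
        simp only [hscore, hfull, Finset.sum_const, Finset.card_fin, smul_eq_mul]
        gcongr
  · simp only [hscore, flatScore_cons_of_ne hy, Finset.mem_toList, List.not_mem_nil, if_false,
      mul_zero, add_zero]
    rw [← Finset.sum_filter, Finset.sum_const, smul_eq_mul]

theorem profileScore_le (ha : ∀ i, a i = if i.val = 0 then b + d else b)
    (P : List (UpToVote L m)) (c : Fin m) :
    profileScore a P c ≤ P.length * b + P.countP (fun V => V.IsFull c) * d := by
  calc
    profileScore a P c ≤ (P.map fun V => b + if V.IsFull c then d else 0).sum :=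
      List.sum_le_sum fun V _ => (V.downScore_eq_flatScore ha c).trans_le (V.flatScore_le c)
    _ = P.length * b + P.countP (fun V => V.IsFull c) * d := by
      simp [List.sum_map_add, List.sum_map_ite, List.countP_eq_length_filter]

theorem countP_mul_le_profileScore (ha : ∀ i, a i = if i.val = 0 then b + d else b)
    (P : List (UpToVote L m)) (y : Fin m) :
    P.countP (fun V => y ∈ V.1) * b ≤ profileScore a P y := by
  calc
    P.countP (fun V => y ∈ V.1) * b = (P.map fun V => if y ∈ V.1 then b else 0).sum := by
      simp [List.sum_map_ite, List.countP_eq_length_filter]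
    _ ≤ profileScore a P y := List.sum_le_sum fun V _ =>
      (Nat.le_add_right _ _).trans (V.downScore_eq_flatScore ha y).ge

theorem sum_countP_mem (P : List (UpToVote L m)) :
    ∑ y, P.countP (fun V => y ∈ V.1) = (P.map fun V => V.1.length).sum := by
  induction P with
  | nil => simp
  | cons V P ih =>
    simp [List.countP_cons, Finset.sum_add_distrib, ih, ← V.sum_mem_eq_length, add_comm]

namespace WAVInstance

variable {I : WAVInstance L}

theorem isYes_iff (ha : ∀ i, a i = if i.val = 0 then b + d else b) :
    I.IsYes a ↔ ∃ P : List (UpToVote L I.numCandidates), P.length = I.numAbsent ∧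
      ∀ y : Fin I.numCandidates,
        I.knownScore b d y + profileScore a P y + (if y < I.target then 1 else 0) ≤
          I.knownScore b d I.target + profileScore a P I.target := by
  have : Nonempty (Fin I.numCandidates) := ⟨I.target⟩
  simp only [IsYes, downWinner_eq_iff, profileScore_append, profileScore_known ha]

theorem feasible_of_isYes (ha : ∀ i, a i = if i.val = 0 then b + d else b) (h : I.IsYes a) :
    I.Feasible b d := by
  obtain ⟨P, hlen, hwin⟩ := (isYes_iff ha).1 h
  set k := P.countP fun V => V.IsFull I.target with hk
  let rank (y : Fin I.numCandidates) : ℕ :=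
    (P.filter fun V => V.IsFull I.target).countP fun V => y ∈ V.1
  have hrank y : rank y ≤ k := by
    rw [hk, List.countP_eq_length_filter]
    exact List.countP_le_length
  have hfits (y : Fin I.numCandidates) : I.Fits b d k y (rank y) := by
    have hscore : rank y * b ≤ profileScore a P y :=
      (Nat.mul_le_mul_right b (List.filter_sublist.countP_le)).trans
        (countP_mul_le_profileScore ha P y)
    have htarget := profileScore_le ha P I.target
    have hy := hwin y
    rw [hlen, ← hk] at htarget
    rw [Fits]
    simp only [Fin.val_fin_lt]
    omega
  refine ⟨k, hlen ▸ Nat.lt_succ_of_le List.countP_le_length,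
    fun y hy => (hfits ⟨y, hy⟩).mono (Nat.zero_le _), ?_⟩
  calc
    k * L = ∑ y, rank y := by
      have hlength : (P.filter fun V => V.IsFull I.target).map (fun V => V.1.length) =
          List.replicate k L := by
        refine List.eq_replicate_iff.2
          ⟨by rw [List.length_map, hk, List.countP_eq_length_filter], fun n hn => ?_⟩
        obtain ⟨V, hV, rfl⟩ := List.mem_map.1 hn
        exact (of_decide_eq_true (List.mem_filter.1 hV).2).2
      rw [sum_countP_mem, hlength, List.sum_replicate, smul_eq_mul]
    _ ≤ ∑ y : Fin I.numCandidates, I.capacity b d k y :=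
      Finset.sum_le_sum fun y _ => (hfits y).le_capacity (hrank y)
    _ = _ := Finset.sum_range _ |>.symm

theorem exists_finsets_card_filter_mem_le_capacity (hL : 1 ≤ L) {k : ℕ}
    (h : k * L ≤ ∑ y ∈ Finset.range I.numCandidates, I.capacity b d k y) :
    ∃ u : Fin k → Finset (Fin I.numCandidates), (∀ i, (u i).card + 1 = L) ∧
      (∀ i, I.target ∉ u i) ∧
      ∀ y, (Finset.univ.filter fun i => y ∈ u i).card ≤ I.capacity b d k y := by
  let r (y : Fin I.numCandidates) : ℕ := if y = I.target then 0 else I.capacity b d k y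
  have hcapacity y : I.capacity b d k y ≤ k := Nat.count_le ..
  have hr : k * (L - 1) ≤ ∑ y, min (r y) k := by
    have hmin y : min (r y) k = r y := by
      refine min_eq_left ?_
      simp only [r]
      split_ifs
      exacts [Nat.zero_le k, hcapacity y]
    have hsum : ∑ y, r y + I.capacity b d k I.target =
        ∑ y : Fin I.numCandidates, I.capacity b d k y := by
      simp only [r, Finset.sum_ite, Finset.sum_const_zero, zero_add, ← ne_eq, Finset.filter_ne']
      exact Finset.sum_erase_add _ _ (Finset.mem_univ _)
    rw [Finset.sum_congr rfl fun y _ => hmin y, Nat.mul_sub_one, Nat.sub_le_iff_le_add]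
    rw [Finset.sum_range, ← hsum] at h
    exact h.trans (Nat.add_le_add_left (hcapacity _) _)
  obtain ⟨u, hcard, hu⟩ := exists_finsets_card_filter_mem_le hr
  refine ⟨u, fun i => by rw [hcard, Nat.sub_add_cancel hL], fun i hi => ?_, fun y => ?_⟩
  · have htarget : (Finset.univ.filter fun i => I.target ∈ u i).card ≤ 0 := by
      simpa [r] using hu I.target
    exact (Finset.card_pos.2 ⟨i, Finset.mem_filter.2 ⟨Finset.mem_univ i, hi⟩⟩).not_ge htarget
  · refine (hu y).trans ?_
    simp only [r]
    split_ifs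
    exacts [Nat.zero_le _, le_rfl]

theorem isYes_of_feasible (hL : 1 ≤ L) (ha : ∀ i, a i = if i.val = 0 then b + d else b)
    (h : I.Feasible b d) : I.IsYes a := by
  obtain ⟨k, hk, hfits, hsum⟩ := h
  obtain ⟨u, hcard, htop, hu⟩ := exists_finsets_card_filter_mem_le_capacity hL hsum
  obtain ⟨P, hlen, htarget, hother⟩ :=
    exists_profile_of_finsets hL ha (Nat.le_of_lt_succ hk) hcard htop
  refine (isYes_iff ha).2 ⟨P, hlen, fun y => ?_⟩
  obtain rfl | hy := eq_or_ne y I.target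
  · simp
  · have hscore : profileScore a P y ≤ I.capacity b d k y * b :=
      (hother y hy).trans_le (Nat.mul_le_mul_right b (hu y))
    have hcapacity := (hfits y y.2).capacity
    simp only [Fits, Fin.val_fin_lt] at hcapacity
    omega

theorem isYes_iff_feasible (hL : 1 ≤ L) (ha : ∀ i, a i = if i.val = 0 then b + d else b) :
    I.IsYes a ↔ I.Feasible b d :=
  ⟨feasible_of_isYes ha, isYes_of_feasible hL ha⟩

end WAVInstance

end Votes

/-! ### Reading the input -/

section Reading

open Computability LoopProgram Port

variable {α : Type} {enc : α → List Γ'} {L n b d : ℕ}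

/-- A step of reading a field of the input. The state consists of the number of commas up to the end
of the field, and of the number of symbols of the field that have been read. -/
def fieldStep : ℕ × ℕ → Γ' → ℕ × ℕ
  | (l, k), Γ'.bit _ => (l, if l = 1 then k + 1 else k)
  | (l, k), Γ'.comma => (l - 1, k)
  | s, _ => s

theorem foldl_fieldStep_zero (k : ℕ) (w : List Γ') : w.foldl fieldStep (0, k) = (0, k) :=
  List.foldl_fixed' (fun x => by cases x <;> rfl) w

theorem foldl_fieldStep_unary (l k v : ℕ) (w : List Γ') :
    (WAVInstance.encodeUnary v ++ Γ'.comma :: w).foldl fieldStep (l, k) =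
      w.foldl fieldStep (l - 1, if l = 1 then k + v else k) := by
  rw [List.foldl_append, List.foldl_cons]
  congr 1
  induction v generalizing k with
  | zero => simp [WAVInstance.encodeUnary, fieldStep]
  | succ v ih =>
    refine (ih _).trans ?_
    split_ifs <;> simp [add_assoc, add_comm 1]

theorem Evaluable.of_foldl_fieldStep {F : α → ℕ} (l : ℕ)
    (hF : ∀ x, (enc x).foldl fieldStep (l, 0) = (0, F x)) :
    Evaluable enc fun x (_ : Fin n → ℕ) => F x := by
  let left : Port n Unit := temp ()
  let step : Γ' → LoopProgram Γ' (Port n Unit)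
    | Γ'.bit _ => ifz left skip (seq (dec left) (seq (ifz left (inc acc) skip) (inc left)))
    | Γ'.comma => dec left
    | _ => skip
  refine ⟨Unit, inferInstance, inferInstance,
    seq (incs (List.replicate l left)) (forIn step), fun x k e _ => ?_⟩
  let state (s : ℕ × ℕ) : Port n Unit → ℕ := valuation (k + s.2) e fun _ => s.1
  have hinit : (incs (List.replicate l left) : LoopProgram Γ' _).run (enc x) (valuation k e 0) =
      state (l, 0) := by
    rw [run_incs]
    ext1 (_ | _ | _) <;> simp [left, state, valuation, List.count_replicate]
  have hstep s y : (step y).run (enc x) (state s) = state (fieldStep s y) := by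
    obtain ⟨_ | _ | l, k'⟩ := s <;> cases y <;> ext1 (_ | _ | _) <;>
      simp [step, run, state, fieldStep, valuation, left, add_assoc]
  rw [run, hinit, run, List.foldl_hom _ hstep, hF]
  rfl

namespace WAVInstance

theorem evaluable_numCandidates :
    Evaluable (encode (L := L)) fun I (_ : Fin n → ℕ) => I.numCandidates :=
  .of_foldl_fieldStep 1 fun I => by
    simp [encode, foldl_fieldStep_unary, foldl_fieldStep_zero, -List.foldl_append]

theorem evaluable_numAbsent :
    Evaluable (encode (L := L)) fun I (_ : Fin n → ℕ) => I.numAbsent :=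
  .of_foldl_fieldStep 2 fun I => by
    simp [encode, foldl_fieldStep_unary, foldl_fieldStep_zero, -List.foldl_append]

theorem evaluable_target :
    Evaluable (encode (L := L)) fun I (_ : Fin n → ℕ) => I.target :=
  .of_foldl_fieldStep 3 fun I => by
    simp [encode, foldl_fieldStep_unary, foldl_fieldStep_zero, -List.foldl_append]

/-- The state of reading the known votes to determine the score of a candidate `y`. -/
@[ext]
structure Scan where
  /-- the score in the votes read so far -/
  score : ℕ
  /-- the truncated difference of `y + 1` and the part of the current entry of the vote read so far,
  so that the entry is `y` if `rest = 1` at its end -/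
  rest : ℕ
  /-- one plus the number of entries of the current vote read so far, and zero between votes -/
  pos : ℕ
  /-- nonzero if the first entry of the current vote is `y` -/
  first : ℕ

namespace Scan

/-- The state after reading one more symbol. The commas between the leading fields of the input are
recognized by `pos = 0`. -/
def step (L b d y : ℕ) (s : Scan) : Γ' → Scan
  | Γ'.bit _ => { s with rest := s.rest - 1 }
  | Γ'.bra => { s with rest := y + 1, pos := 1 }
  | Γ'.comma =>
    if s.pos = 0 then s
    else
      { score := s.score + if s.rest = 1 then b else 0
        rest := y + 1
        pos := s.pos + 1
        first := s.first + if s.pos = 1 ∧ s.rest = 1 then 1 else 0 }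
  | Γ'.ket => ⟨s.score + if s.first ≠ 0 ∧ L < s.pos then d else 0, 0, 0, 0⟩
  | Γ'.blank => s

section

variable (L b d) (y : ℕ)

theorem foldl_step_encodeUnary (s : Scan) (v : ℕ) :
    (encodeUnary v).foldl (step L b d y) s = { s with rest := s.rest - v } := by
  induction v generalizing s with
  | zero => rfl
  | succ v ih =>
    refine (ih _).trans ?_
    simp only [step, Nat.sub_sub, add_comm 1]

theorem foldl_step_entries (k p f : ℕ) (R : List ℕ) :
    (R.flatMap fun x => encodeUnary x ++ [Γ'.comma]).foldl (step L b d y) ⟨k, y + 1, p + 1, f⟩ =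
      ⟨k + R.count y * b, y + 1, p + 1 + R.length,
        f + if p = 0 ∧ R.head? = some y then 1 else 0⟩ := by
  induction R generalizing k p f with
  | nil => simp
  | cons x R ih =>
    have hx : y + 1 - x = 1 ↔ x = y := by omega
    simp only [List.flatMap_cons, List.foldl_append, foldl_step_encodeUnary, List.foldl_cons,
      List.foldl_nil, step, Nat.succ_ne_zero, if_false, ih, hx, List.count_cons]
    ext
    case score => simp only [beq_iff_eq]; split_ifs <;> ring
    case rest => rfl
    case pos => simp only [List.length_cons]; ring
    case first => simp

theorem foldl_step_encodeVote {m : ℕ} (k : ℕ) (V : UpToVote L m) :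
    (encodeVote V).foldl (step L b d y) ⟨k, 0, 0, 0⟩ =
      ⟨k + flatScore L b d (V.1.map Fin.val) y, 0, 0, 0⟩ := by
  have hentries := foldl_step_entries L b d y k 0 0 (V.1.map Fin.val)
  rw [List.flatMap_map] at hentries
  have hcount : (V.1.map Fin.val).count y = if y ∈ V.1.map Fin.val then 1 else 0 :=
    List.Nodup.count (V.2.1.map Fin.val_injective)
  have hlength := V.2.2.2
  rw [encodeVote, List.cons_append, List.foldl_cons, List.foldl_append]
  change List.foldl _ (List.foldl _ (⟨k, y + 1, 0 + 1, 0⟩ : Scan) _) _ = _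
  rw [hentries, hcount]
  have hfull : L < 1 + V.1.length ↔ V.1.length = L := by omega
  simp [step, flatScore, hfull, add_assoc]

theorem foldl_step_encodeUnary_comma (k v : ℕ) (w : List Γ') :
    (encodeUnary v ++ Γ'.comma :: w).foldl (step L b d y) ⟨k, 0, 0, 0⟩ =
      w.foldl (step L b d y) ⟨k, 0, 0, 0⟩ := by
  simp [foldl_step_encodeUnary, step]

theorem foldl_step_encode (I : WAVInstance L) :
    I.encode.foldl (step L b d y) ⟨0, 0, 0, 0⟩ = ⟨I.knownScore b d y, 0, 0, 0⟩ := by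
  have hvotes k (P : List (UpToVote L I.numCandidates)) :
      (P.flatMap encodeVote).foldl (step L b d y) ⟨k, 0, 0, 0⟩ =
        ⟨k + (P.map fun V => flatScore L b d (V.1.map Fin.val) y).sum, 0, 0, 0⟩ := by
    induction P generalizing k with
    | nil => rfl
    | cons V P ih =>
      rw [List.flatMap_cons, List.foldl_append, foldl_step_encodeVote, ih, List.map_cons,
        List.sum_cons, add_assoc]
  simp only [encode, foldl_step_encodeUnary_comma, hvotes, zero_add, knownScore]

end

/-- The registers for intermediate results of `stepProgram`. -/
inductive Register : Type
  | rest
  | pos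
  | first
  | spare
  deriving DecidableEq

instance : Fintype Register :=
  ⟨{.rest, .pos, .first, .spare}, fun r => by cases r <;> decide⟩

/-- The values of the registers in a given state. -/
def values (s : Scan) : Register → ℕ
  | .rest => s.rest
  | .pos => s.pos
  | .first => s.first
  | .spare => 0

/-- The program that prepares for reading an entry of a vote. -/
def startEntry (i : Fin n) : LoopProgram Γ' (Port n Register) :=
  seq (clear (temp .rest)) (seq (copy (arg i) (temp .rest) (temp .spare)) (inc (temp .rest)))

/-- The program for the end of an entry of a vote. It tests `rest = 1` and `pos = 1` by decrementing
these registers. -/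
def endEntry (b : ℕ) : LoopProgram Γ' (Port n Register) :=
  seq (dec (temp .pos)) <|
  seq (ifz (temp .rest) skip <| seq (dec (temp .rest)) <| ifz (temp .rest)
    (seq (incs (List.replicate b acc)) (ifz (temp .pos) (inc (temp .first)) skip)) skip) <|
  seq (inc (temp .pos)) (inc (temp .pos))

/-- The program for the end of a vote. -/
def endVote (L d : ℕ) : LoopProgram Γ' (Port n Register) :=
  seq (seq (incs (List.replicate L (temp .spare))) (drain (temp .spare) (temp .pos))) <|
  seq (ifz (temp .pos) skip (ifz (temp .first) skip (incs (List.replicate d acc)))) <|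
  seq (clear (temp .rest)) (seq (clear (temp .pos)) (clear (temp .first)))

/-- The program for `Scan.step`, where the candidate is the argument `i`. -/
def stepProgram (L b d : ℕ) (i : Fin n) : Γ' → LoopProgram Γ' (Port n Register)
  | Γ'.bit _ => dec (temp .rest)
  | Γ'.bra => seq (startEntry i) (seq (clear (temp .pos)) (inc (temp .pos)))
  | Γ'.comma => ifz (temp .pos) skip (seq (endEntry b) (startEntry i))
  | Γ'.ket => endVote L d
  | Γ'.blank => skip

theorem run_startEntry {w : List Γ'} {i : Fin n} {k : ℕ} {e : Fin n → ℕ} (he : e i ≤ w.length)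
    (s : Scan) : (startEntry i).run w (valuation k e s.values) =
      valuation k e { s with rest := e i + 1 }.values := by
  rw [startEntry, run, run_clear, run, run_copy w (by simp) (by simp) (by simp) (by simpa)
    (by simp [valuation, values])]
  ext1 (_ | _ | _ | _) <;> simp [run, valuation, values]

theorem run_endEntry (w : List Γ') (k : ℕ) (e : Fin n → ℕ) {s : Scan} (hpos : s.pos ≠ 0) :
    (endEntry b).run w (valuation k e s.values) =
      valuation (k + if s.rest = 1 then b else 0) e
        { s with
          rest := s.rest - 1
          pos := s.pos + 1
          first := s.first + if s.pos = 1 ∧ s.rest = 1 then 1 else 0 }.values := by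
  obtain ⟨_, _ | _ | r, _ | _ | p, f⟩ := s
  case zero | succ.zero.zero | succ.succ.zero => exact (hpos rfl).elim
  all_goals
    ext1 (_ | _ | _ | _) <;> simp [endEntry, run, run_incs, List.count_replicate, valuation, values]

theorem run_endVote (w : List Γ') (k : ℕ) (e : Fin n → ℕ) (s : Scan) :
    (endVote L d).run w (valuation k e s.values) =
      valuation (k + if s.first ≠ 0 ∧ L < s.pos then d else 0) e
        { s with rest := 0, pos := 0, first := 0 }.values := by
  obtain ⟨_, _, p, _ | f⟩ := s <;> by_cases hp : L < p
  all_goals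
    have hp' : p - L = 0 ↔ ¬ L < p := by omega
    ext1 (_ | _ | _ | _) <;>
      simp [endVote, run, run_incs, run_clear, List.count_replicate, valuation, values, hp, hp']

theorem run_stepProgram {w : List Γ'} {i : Fin n} {k : ℕ} {e : Fin n → ℕ} (he : e i ≤ w.length)
    (s : Scan) (x : Γ') : (stepProgram L b d i x).run w (valuation (k + s.score) e s.values) =
      valuation (k + (step L b d (e i) s x).score) e (step L b d (e i) s x).values := by
  cases x
  case blank => rfl
  case bit => ext1 (_ | _ | _ | _) <;> simp [stepProgram, step, run, valuation, values]
  case bra =>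
    rw [stepProgram, run, run_startEntry he]
    ext1 (_ | _ | _ | _) <;> simp [step, run, run_clear, valuation, values]
  case comma =>
    by_cases hpos : s.pos = 0
    · simp [stepProgram, step, run, valuation, values, hpos]
    · have htemp : valuation (k + s.score) e s.values (temp .pos) ≠ 0 := hpos
      rw [stepProgram, run, if_neg htemp, run, run_endEntry w _ e hpos, run_startEntry he, step,
        if_neg hpos, add_assoc]
      rfl
  case ket =>
    rw [stepProgram, run_endVote, step, add_assoc]
    rfl

end Scan

theorem evaluable_knownScore (i : Fin n) :
    Evaluable (encode (L := L)) fun I e => I.knownScore b d (e i) := by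
  refine ⟨Scan.Register, inferInstance, inferInstance, forIn (Scan.stepProgram L b d i),
    fun I k e he => ?_⟩
  have hvalues c : (⟨c, 0, 0, 0⟩ : Scan).values = 0 := by ext1 (_ | _) <;> rfl
  have hrun := List.foldl_hom (fun s : Scan => valuation (k + s.score) e s.values)
    (g₁ := Scan.step L b d (e i)) (g₂ := fun v x => (Scan.stepProgram L b d i x).run I.encode v)
    (Scan.run_stepProgram (he i).le) (l := I.encode) (init := ⟨0, 0, 0, 0⟩)
  rwa [Scan.foldl_step_encode, hvalues, hvalues] at hrun

theorem length_encode_ge (I : WAVInstance L) :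
    I.numCandidates + I.numAbsent + 3 ≤ I.encode.length := by
  simp only [encode, encodeUnary, List.length_append, List.length_replicate, List.length_cons]
  omega

theorem numCandidates_lt_length_encode (I : WAVInstance L) : I.numCandidates < I.encode.length := by
  have := I.length_encode_ge
  omega

theorem numAbsent_lt_length_encode (I : WAVInstance L) : I.numAbsent < I.encode.length := by
  have := I.length_encode_ge
  omega

theorem evaluable_knownScore_target :
    Evaluable (encode (L := L)) fun I (_ : Fin n → ℕ) => I.knownScore b d I.target :=
  (evaluable_knownScore 0).subst evaluable_target fun I _ _ =>
    I.target.2.trans I.numCandidates_lt_length_encode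

theorem evaluablePred_fits {J : (Fin n → ℕ) → ℕ} (i k : Fin n)
    (hJ : Evaluable (encode (L := L)) fun _ e => J e) :
    EvaluablePred (encode (L := L)) fun I e => I.Fits b d (e k) (e i) (J e) := by
  have hlhs : Evaluable (encode (L := L)) fun I e =>
      I.knownScore b d (e i) + (if e i < I.target then 1 else 0) + b * J e :=
    ((evaluable_knownScore i).add
      (.ite (.lt (.var i) evaluable_target) (.const 1) (.const 0))).add (hJ.const_mul b)
  have hrhs : Evaluable (encode (L := L)) fun I e =>
      I.knownScore b d I.target + b * I.numAbsent + d * e k :=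
    (evaluable_knownScore_target.add (evaluable_numAbsent.const_mul b)).add
      ((Evaluable.var k).const_mul d)
  exact (EvaluablePred.le hlhs hrhs).congr fun I e _ => by
    rw [Fits, mul_comm b, mul_comm b, mul_comm d]

theorem evaluable_capacity (i k : Fin n) :
    Evaluable (encode (L := L)) fun I e => I.capacity b d (e k) (e i) :=
  Evaluable.count (P := fun I e => Fits I b d (e k.succ) (e i.succ) (e 0 + 1))
    (evaluablePred_fits i.succ k.succ ((Evaluable.var 0).add (.const 1))) (.var k)
    fun _ _ he => (he k).le

theorem evaluablePred_feasible :
    EvaluablePred (encode (L := L)) fun I (_ : Fin n → ℕ) => I.Feasible b d := by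
  have hfits : EvaluablePred (encode (L := L)) fun I (e : Fin (n + 1) → ℕ) =>
      ∀ y < I.numCandidates, I.Fits b d (e 0) y 0 :=
    (evaluablePred_fits 0 1 (.const 0)).forall_lt evaluable_numCandidates
      fun I _ _ => I.numCandidates_lt_length_encode.le
  have hsum : Evaluable (encode (L := L)) fun I (e : Fin (n + 1) → ℕ) =>
      ∑ y ∈ Finset.range I.numCandidates, I.capacity b d (e 0) y :=
    (evaluable_capacity 0 1).sum_range evaluable_numCandidates
      fun I _ _ => I.numCandidates_lt_length_encode.le
  have hbody := hfits.and (.le ((Evaluable.var 0).const_mul L) hsum)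
  refine (hbody.exists_lt (evaluable_numAbsent.add (.const 1))
    fun I _ _ => I.numAbsent_lt_length_encode).congr fun I e _ => ?_
  simp only [Fin.cons_zero, Feasible, mul_comm L]

end WAVInstance

end Reading

theorem theorem8 (L : ℕ) (hL : 2 ≤ L) (a : Fin L → ℕ) (ha : Antitone a)
    (hflat : ∀ i j : Fin L, 1 ≤ i.val → 1 ≤ j.val → a i = a j) :
    DecidableInPolyTime (WAVInstance.encode (L := L)) (WAVInstance.IsYes a) := by
  let top : Fin L := ⟨0, by omega⟩
  let second : Fin L := ⟨1, hL⟩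
  obtain ⟨d, hd⟩ := Nat.exists_eq_add_of_le (ha (show top ≤ second from Nat.zero_le 1))
  have hscore i : a i = if i.val = 0 then a second + d else a second := by
    split_ifs with hi
    · exact (congrArg a (Fin.ext hi)).trans hd
    · exact hflat i second (Nat.one_le_iff_ne_zero.2 hi) le_rfl
  exact (WAVInstance.evaluablePred_feasible.congr fun I _ _ =>
    (WAVInstance.isYes_iff_feasible (one_le_two.trans hL) hscore).symm).decidableInPolyTime
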